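/- Let $\mathbb K$ be an algebraically closed field of characteristic zero; all vector spaces are finite-dimensional over $\mathbb K$. For a linear map $\varphi:X\to\mathrm{End}(V)$ let $\varphi^*:X\to\mathrm{End}(V^*)$ be given by $\langle\varphi^*(x)u,v\rangle=-\langle u,\varphi(x)v\rangle$; for a linear map $T$ let $T^*$ be the usual dual map. **Definitions.** A *relative Poisson algebra* $(X,\cdot,[-,-],P)$ is a commutative associative algebra $(X,\cdot)$ and a Lie algebra $(X,[-,-])$ with a derivation $P$ of both such that $[z,x\cdot y]=[z,x]\cdot y+x\cdot[z,y]+x\cdot y\cdot P(z)$. A *Jacobi algebra* is a unital commutative associative algebra with a Lie bracket such that the same identity holds with $P=\mathrm{ad}(1_X)$; it is *Frobenius* with respect to $\mathcal B$ if $\mathcal B$ is a nondegenerate symmetric bilinear form with $\mathcal B(x\cdot y,z)=\mathcal B(x,y\cdot z)$ and $\mathcal B([x,y],z)=\mathcal B(x,[y,z])$. Write $\mathcal L(x)y=x\cdot y$ and $\mathrm{ad}(x)y=[x,y]$. A *relative pre-Poisson algebra* $(A,\star,\circ,P)$ is a vector space with bilinear operations $\star,\circ$ and a derivation $P$ of both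 such that $$x\star(y\star z)=(y\star x)\star z+(x\star y)\star z,\qquad (x\circ y)\circ z-x\circ(y\circ z)=(y\circ x)\circ z-y\circ(x\circ z),$$ $$(x\star y+y\star x)\circ z-x\star(y\circ z)-y\star(x\circ z)+(x\star y+y\star x)\star P(z)=0,$$ $$y\circ(x\star z)-x\star(y\circ z)+(x\circ y-y\circ x)\star z-(x\star P(y)+P(y)\star x)\star z=0 .$$ A linear map $Q:X\to X$ *dually represents* a relative Poisson algebra $(X,P)$ if $(-\mathcal L^*,\mathrm{ad}^*,Q^*,X^*)$ is a representation of it, equivalently if, for all $x,y,z\in X$, $x\cdot Q(y)-P(x)\cdot y-Q(x\cdot y)=0$, $[x,Q(y)]-[P(x),y]-Q([x,y])=0$ and $(P+Q)(x\cdot y\cdot z)=0$. For $r=\sum_i a_i\otimes b_i\in X\otimes X$ and a bilinear operation $\diamond$ put $r_{12}\diamond r_{13}=\sum a_i\diamond a_j\otimes b_i\otimes b_j$, $r_{12}\diamond r_{23}=\sum a_i\otimes b_i\diamond a_j\otimes b_j$, $r_{13}\diamond r_{23}=\sum a_i\otimes a_j\otimes b_i\diamond b_j$. Then $r$ is a solution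 of the *$Q$-RPYBE* in $(X,P)$ if $$r_{12}\cdot r_{13}-r_{12}\cdot r_{23}+r_{13}\cdot r_{23}=0,\qquad [r_{12},r_{13}]+[r_{12},r_{23}]+[r_{13},r_{23}]=0,$$ $$(P\otimes\mathrm{id}-\mathrm{id}\otimes Q)r=0,\qquad (Q\otimes\mathrm{id}-\mathrm{id}\otimes P)r=0 .$$ A *relative Poisson bialgebra* $(X,\cdot,[-,-],\Delta,\delta,P,Q)$ is a relative Poisson algebra $(X,\cdot,[-,-],P)$ with linear maps $\Delta,\delta:X\to X\otimes X$ and $Q:X\to X$ such that: $(X^*,\Delta^*,\delta^*,Q^*)$ is a relative Poisson algebra; $\Delta(x\cdot y)=(\mathcal L(x)\otimes\mathrm{id})\Delta(y)+(\mathrm{id}\otimes\mathcal L(y))\Delta(x)$; $\delta([x,y])=(\mathrm{ad}(x)\otimes\mathrm{id}+\mathrm{id}\otimes\mathrm{ad}(x))\delta(y)-(\mathrm{ad}(y)\otimes\mathrm{id}+\mathrm{id}\otimes\mathrm{ad}(y))\delta(x)$; $Q$ dually represents $(X,P)$; $P^*$ dually represents $(X^*,Q^*)$; and $$\delta(x\cdot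 y)-(\mathrm{id}\otimes\mathrm{ad}(y))\Delta(x)-(\mathcal L(x)\otimes\mathrm{id})\delta(y)-(\mathrm{id}\otimes\mathrm{ad}(x))\Delta(y)-(\mathcal L(y)\otimes\mathrm{id})\delta(x)-(\mathrm{id}\otimes Q)\Delta(x\cdot y)=0,$$ $$\Delta([x,y])-(\mathcal L(y)\otimes\mathrm{id})\delta(x)-(\mathrm{id}\otimes\mathrm{ad}(x))\Delta(y)+(\mathrm{id}\otimes\mathcal L(y))\delta(x)-(\mathrm{ad}(x)\otimes\mathrm{id})\Delta(y)+\Delta(P(x)\cdot y)=0 .$$ Its *induced relative Poisson algebra* $X\bowtie X^*$ is $X\oplus X^*$ with the map $P+Q^*$ and, with $\cdot$ and $[-,-]$ on $X^*$ dual to $\Delta$ and $\delta$, with the operations (using $X^{**}=X$) $$(x+a)\cdot(y+b)=x\cdot y-\mathcal L_{X^*}^*(a)y-\mathcal L_{X^*}^*(b)x+a\cdot b-\mathcal L_X^*(x)b-\mathcal L_X^*(y)a,$$ $$[x+a,y+b]=[x,y]+\mathrm{ad}_{X^*}^*(a)y-\mathrm{ad}_{X^*}^*(b)x+[a,b]+\mathrm{ad}_X^*(x)b-\mathrm{ad}_X^*(y)a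 .$$ On it put $\mathcal B_d(x+a,y+b)=\langle x,b\rangle+\langle a,y\rangle$. **Theorem.** Let $(A,\star,\circ,P)$ be a relative pre-Poisson algebra. Put $x\cdot y=x\star y+y\star x$ and $[x,y]=x\circ y-y\circ x$. Then $(A,\cdot,[-,-],P)$ is a relative Poisson algebra (the sub-adjacent one). Let $\tilde A=A\oplus\mathbb Ke$, where $\cdot$ and $[-,-]$ are extended so that $e$ is the unit and $[e,x]=-[x,e]=P(x)$, $[e,e]=0$, and let $\tilde P$ extend $P$ by $\tilde P(e)=0$; $\tilde A$ is a Jacobi algebra (the extended Jacobi algebra). Let $\mu,\rho:\tilde A\to\mathrm{End}(A)$ be given by $\mu(x)y=x\star y$, $\mu(e)=\mathrm{id}$, $\rho(x)y=x\circ y$, $\rho(e)=P$, and let $\tilde A\ltimes A^*$ be $\tilde A\oplus A^*$ with $$(x+u)\cdot(y+v)=x\cdot y-\mu^*(x)v-\mu^*(y)u,\qquad [x+u,y+v]=[x,y]+\rho^*(x)v-\rho^*(y)u,$$ for $x,y\in\tilde A$, $u,v\in A^*$. Let $\{e_1,\dots,e_n\}$ be a basis of $A$ with dual basis $\{e_1^*,\dots,e_n^*\}$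 and $$r=\sum_{i=1}^n(e_i\otimes e_i^*-e_i^*\otimes e_i)\in(\tilde A\ltimes A^*)\otimes(\tilde A\ltimes A^*).$$ Then: 1. $(\tilde A\ltimes A^*,\tilde P-P^*)$ is a unital relative Poisson algebra with unit $e$, and $r$ is an antisymmetric solution of the $(-\tilde P+P^*)$-RPYBE in it. 2. With $\Delta(x)=(\mathrm{id}\otimes\mathcal L(x)-\mathcal L(x)\otimes\mathrm{id})r$ and $\delta(x)=(\mathrm{ad}(x)\otimes\mathrm{id}+\mathrm{id}\otimes\mathrm{ad}(x))r$ for $x\in\tilde A\ltimes A^*$, the collection $(\tilde A\ltimes A^*,\cdot,[-,-],\Delta,\delta,\tilde P-P^*,-\tilde P+P^*)$ is a relative Poisson bialgebra. 3. The induced relative Poisson algebra $(\tilde A\ltimes A^*)\bowtie(\tilde A\ltimes A^*)^*$ is a Jacobi algebra with unit $e$, and it is Frobenius with respect to $\mathcal B_d$. -/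

import Mathlib

set_option maxSynthPendingDepth 3
set_option linter.unnecessarySeqFocus false

open scoped TensorProduct

namespace RelativePoisson

/-! An algebra structure is a vector space together with bilinear operations
`A →ₗ[K] A →ₗ[K] A`. For such an operation `m`, the linear map `m x` is the operator of left
multiplication by `x`: it is `𝓛(x)` for a product and `ad(x)` for a Lie bracket.
All notions below are those for vector spaces over a field `K`. -/

section Algebras

variable {K A V : Type*} [Field K] [AddCommGroup A] [Module K A] [AddCommGroup V] [Module K V]

/-- `(A, ·)` is a (not necessarily unital) commutative associative algebra. -/
structure IsCommAssoc (mul : A →ₗ[K] A →ₗ[K] A) : Prop where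
  comm : ∀ x y, mul x y = mul y x
  assoc : ∀ x y z, mul (mul x y) z = mul x (mul y z)

/-- `e` is a unit of the commutative algebra `(A, ·)`. -/
def IsUnitElement (mul : A →ₗ[K] A →ₗ[K] A) (e : A) : Prop :=
  ∀ x, mul e x = x ∧ mul x e = x

/-- `(A, [-,-])` is a Lie algebra. -/
structure IsLie (br : A →ₗ[K] A →ₗ[K] A) : Prop where
  self : ∀ x, br x x = 0
  jacobi : ∀ x y z, br x (br y z) + br y (br z x) + br z (br x y) = 0

/-- `P` is a derivation of the algebra `(A, m)`. -/
def IsDerivation (m : A →ₗ[K] A →ₗ[K] A) (P : A →ₗ[K] A) : Prop :=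
  ∀ x y, P (m x y) = m (P x) y + m x (P y)

/-- `(A, ·, [-,-], P)` is a relative Poisson algebra. -/
structure IsRelativePoisson (mul br : A →ₗ[K] A →ₗ[K] A) (P : A →ₗ[K] A) : Prop where
  commAssoc : IsCommAssoc mul
  lie : IsLie br
  derivation_mul : IsDerivation mul P
  derivation_br : IsDerivation br P
  leibniz : ∀ x y z,
    br z (mul x y) = mul (br z x) y + mul x (br z y) + mul (mul x y) (P z)

/-- `(A, ·, [-,-])` is a Jacobi algebra with unit `e`. -/
structure IsJacobi (mul br : A →ₗ[K] A →ₗ[K] A) (e : A) : Prop where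
  commAssoc : IsCommAssoc mul
  isUnit : IsUnitElement mul e
  lie : IsLie br
  leibniz : ∀ x y z,
    br z (mul x y) = mul (br z x) y + mul x (br z y) + mul (mul x y) (br e z)

/-- `(A, ·, [-,-])` is a Jacobi algebra with unit `e` which is Frobenius by means of the
nondegenerate symmetric invariant bilinear form `B`. -/
structure IsFrobeniusJacobi (mul br : A →ₗ[K] A →ₗ[K] A) (e : A)
    (B : LinearMap.BilinForm K A) : Prop where
  jacobi : IsJacobi mul br e
  nondegenerate : B.Nondegenerate
  symm : B.IsSymm
  invariant_mul : ∀ x y z, B (mul x y) z = B x (mul y z)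
  invariant_br : ∀ x y z, B (br x y) z = B x (br y z)

/-- `(A, ⋆, ∘, P)` is a relative pre-Poisson algebra: `(A, ⋆)` is a Zinbiel algebra, `(A, ∘)` is
a pre-Lie algebra, `P` is a derivation of both, and two compatibility conditions hold. -/
structure IsRelativePrePoisson (star circ : A →ₗ[K] A →ₗ[K] A) (P : A →ₗ[K] A) : Prop where
  zinbiel : ∀ x y z, star x (star y z) = star (star y x) z + star (star x y) z
  preLie : ∀ x y z,
    circ (circ x y) z - circ x (circ y z) = circ (circ y x) z - circ y (circ x z)
  derivation_star : IsDerivation star P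
  derivation_circ : IsDerivation circ P
  compat₁ : ∀ x y z,
    circ (star x y + star y x) z - star x (circ y z) - star y (circ x z)
      + star (star x y + star y x) (P z) = 0
  compat₂ : ∀ x y z,
    circ y (star x z) - star x (circ y z) + star (circ x y - circ y x) z
      - star (star x (P y) + star (P y) x) z = 0

/-- The product `x · y = x ⋆ y + y ⋆ x` of the sub-adjacent relative Poisson algebra. -/
def subMul (star : A →ₗ[K] A →ₗ[K] A) : A →ₗ[K] A →ₗ[K] A := star + star.flip

/-- The bracket `[x, y] = x ∘ y - y ∘ x` of the sub-adjacent relative Poisson algebra. -/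
def subBr (circ : A →ₗ[K] A →ₗ[K] A) : A →ₗ[K] A →ₗ[K] A := circ - circ.flip

/-- `(μ, ρ, α, V)` is a representation of the relative Poisson algebra `(A, ·, [-,-], P)`. -/
structure IsRepresentation (mul br : A →ₗ[K] A →ₗ[K] A) (P : A →ₗ[K] A)
    (μ ρ : A →ₗ[K] Module.End K V) (α : V →ₗ[K] V) : Prop where
  rep_mul : ∀ x y v, μ (mul x y) v = μ x (μ y v)
  rep_unit : ∀ e, IsUnitElement mul e → ∀ v, μ e v = v
  rep_br : ∀ x y v, ρ (br x y) v = ρ x (ρ y v) - ρ y (ρ x v)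
  compatible : ∀ x y v, ρ y (μ x v) - μ x (ρ y v) + μ (br x y) v - μ (mul x (P y)) v = 0
  map_mul : ∀ x v, α (μ x v) - μ (P x) v - μ x (α v) = 0
  map_br : ∀ x v, α (ρ x v) - ρ (P x) v - ρ x (α v) = 0
  leibniz : ∀ x y v,
    ρ (mul x y) v - μ x (ρ y v) - μ y (ρ x v) + μ (mul x y) (α v) = 0

/-- The map `φ* : A → End(V*)` attached to `φ : A → End(V)`, characterized by
`⟨φ*(x) u, v⟩ = -⟨u, φ(x) v⟩`. -/
noncomputable def dualRep (φ : A →ₗ[K] Module.End K V) :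
    A →ₗ[K] Module.End K (Module.Dual K V) :=
  -(Module.Dual.transpose ∘ₗ φ)

theorem dualRep_apply (φ : A →ₗ[K] Module.End K V) (x : A) (u : Module.Dual K V) (v : V) :
    dualRep φ x u v = -u (φ x v) := rfl

/-- `Q` dually represents `(A, ·, [-,-], P)`: the quadruple `(-𝓛*, ad*, Q*, A*)` is a
representation. -/
def DuallyRepresents (mul br : A →ₗ[K] A →ₗ[K] A) (P Q : A →ₗ[K] A) : Prop :=
  IsRepresentation mul br P (-dualRep mul) (dualRep br) Q.dualMap

end Algebras

section Constructions

variable {K A V : Type*} [Field K] [AddCommGroup A] [Module K A] [AddCommGroup V] [Module K V]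

/-- The product `(x + u) · (y + v) = x · y + μ(x) v + μ(y) u` on `A ⊕ V`. -/
def semidirectMul (mul : A →ₗ[K] A →ₗ[K] A) (μ : A →ₗ[K] Module.End K V) :
    (A × V) →ₗ[K] (A × V) →ₗ[K] (A × V) :=
  LinearMap.mk₂ K (fun p q => (mul p.1 q.1, μ p.1 q.2 + μ q.1 p.2))
    (fun p p' q => by ext <;> simp <;> abel)
    (fun c p q => by ext <;> simp)
    (fun p q q' => by ext <;> simp <;> abel)
    (fun c p q => by ext <;> simp)

/-- The bracket `[x + u, y + v] = [x, y] + ρ(x) v - ρ(y) u` on `A ⊕ V`. -/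
def semidirectBr (br : A →ₗ[K] A →ₗ[K] A) (ρ : A →ₗ[K] Module.End K V) :
    (A × V) →ₗ[K] (A × V) →ₗ[K] (A × V) :=
  LinearMap.mk₂ K (fun p q => (br p.1 q.1, ρ p.1 q.2 - ρ q.1 p.2))
    (fun p p' q => by ext <;> simp <;> abel)
    (fun c p q => by ext <;> simp [smul_sub])
    (fun p q q' => by ext <;> simp <;> abel)
    (fun c p q => by ext <;> simp [smul_sub])

/-- The product of the extended Jacobi algebra `A ⊕ K e`, where `(x, s)` stands for `x + s e`:
it extends the product of `A`, and `e` is the unit. -/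
def extMul (mul : A →ₗ[K] A →ₗ[K] A) : (A × K) →ₗ[K] (A × K) →ₗ[K] (A × K) :=
  LinearMap.mk₂ K (fun p q => (mul p.1 q.1 + p.2 • q.1 + q.2 • p.1, p.2 * q.2))
    (fun p p' q => by ext <;> simp [add_smul, add_mul]; abel)
    (fun c p q => by ext <;> simp [mul_smul, mul_assoc, smul_comm c])
    (fun p q q' => by ext <;> simp [add_smul, mul_add]; abel)
    (fun c p q => by ext <;> simp [mul_smul, mul_left_comm, smul_comm c])

/-- The bracket of the extended Jacobi algebra `A ⊕ K e`: it extends the bracket of `A`, and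
`[e, x] = -[x, e] = P(x)`, `[e, e] = 0`. -/
def extBr (br : A →ₗ[K] A →ₗ[K] A) (P : A →ₗ[K] A) :
    (A × K) →ₗ[K] (A × K) →ₗ[K] (A × K) :=
  LinearMap.mk₂ K (fun p q => (br p.1 q.1 + p.2 • P q.1 - q.2 • P p.1, 0))
    (fun p p' q => by ext <;> simp [add_smul]; abel)
    (fun c p q => by ext <;> simp [mul_smul, smul_sub, smul_comm c])
    (fun p q q' => by ext <;> simp [add_smul]; abel)
    (fun c p q => by ext <;> simp [mul_smul, smul_sub, smul_comm c])

/-- The map `P̃` on `A ⊕ K e`: it extends `P`, and `P̃(e) = 0`. -/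
def extP (P : A →ₗ[K] A) : (A × K) →ₗ[K] (A × K) := P.prodMap 0

/-- The extension `φ̃` to `A ⊕ K e` of a map `φ : A → End(V)` with `φ̃(e) = α`. -/
def extRep (φ : A →ₗ[K] Module.End K V) (α : Module.End K V) :
    (A × K) →ₗ[K] Module.End K V :=
  φ.coprod (LinearMap.toSpanSingleton K (Module.End K V) α)

end Constructions

section PrePoisson

variable {K A : Type*} [Field K] [AddCommGroup A] [Module K A]

/-- The underlying vector space `(A ⊕ K e) ⊕ A*` of the semi-direct product `Ã ⋉ A*`. -/
abbrev ExtDual (K A : Type*) [Field K] [AddCommGroup A] [Module K A] : Type _ :=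
  (A × K) × Module.Dual K A

/-- The product of the semi-direct product `Ã ⋉ A*` formed with the representation
`-(𝓛̃_⋆)*`, where `𝓛̃_⋆` extends `𝓛_⋆` by `e ↦ id`. -/
noncomputable def extDualMul (star : A →ₗ[K] A →ₗ[K] A) :
    ExtDual K A →ₗ[K] ExtDual K A →ₗ[K] ExtDual K A :=
  semidirectMul (extMul (subMul star)) (-dualRep (extRep star LinearMap.id))

/-- The bracket of the semi-direct product `Ã ⋉ A*` formed with the representation
`(𝓛̃_∘)*`, where `𝓛̃_∘` extends `𝓛_∘` by `e ↦ P`. -/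
noncomputable def extDualBr (circ : A →ₗ[K] A →ₗ[K] A) (P : A →ₗ[K] A) :
    ExtDual K A →ₗ[K] ExtDual K A →ₗ[K] ExtDual K A :=
  semidirectBr (extBr (subBr circ) P) (dualRep (extRep circ P))

/-- The map `P̃ - P*` on `Ã ⋉ A*`, that is, `P̃` on `Ã` and `-P*` on `A*`. -/
noncomputable def extDualP (P : A →ₗ[K] A) : ExtDual K A →ₗ[K] ExtDual K A :=
  (extP P).prodMap (-P.dualMap)

/-- The element `e` of `Ã ⋉ A*`. -/
def extDualUnit (K A : Type*) [Field K] [AddCommGroup A] [Module K A] : ExtDual K A :=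
  ((0, 1), 0)

/-- The tensor `r = ∑ i, (e_i ⊗ e_i* - e_i* ⊗ e_i)` of a basis and its dual basis. -/
noncomputable def extDualTensor {n : ℕ} (b : Module.Basis (Fin n) K A) :
    ExtDual K A ⊗[K] ExtDual K A :=
  ∑ i, ((((b i, 0), 0) : ExtDual K A) ⊗ₜ[K] ((0, b.coord i) : ExtDual K A)
    - ((0, b.coord i) : ExtDual K A) ⊗ₜ[K] (((b i, 0), 0) : ExtDual K A))

end PrePoisson

section Tensors

variable {K A : Type*} [Field K] [AddCommGroup A] [Module K A]

/-- `f ⊗ id` on `A ⊗ A`. -/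
noncomputable abbrev onLeft (f : A →ₗ[K] A) : A ⊗[K] A →ₗ[K] A ⊗[K] A :=
  TensorProduct.map f LinearMap.id

/-- `id ⊗ f` on `A ⊗ A`. -/
noncomputable abbrev onRight (f : A →ₗ[K] A) : A ⊗[K] A →ₗ[K] A ⊗[K] A :=
  TensorProduct.map LinearMap.id f

/-- The exchange `τ(x ⊗ y) = y ⊗ x`. -/
noncomputable abbrev swap : A ⊗[K] A →ₗ[K] A ⊗[K] A :=
  (TensorProduct.comm K A A).toLinearMap

/-- The cyclic permutation `ξ(x ⊗ y ⊗ z) = y ⊗ z ⊗ x`. -/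
noncomputable def cyc : A ⊗[K] (A ⊗[K] A) →ₗ[K] A ⊗[K] (A ⊗[K] A) :=
  (TensorProduct.assoc K A A A).toLinearMap ∘ₗ
    (TensorProduct.comm K A (A ⊗[K] A)).toLinearMap

/-- `id ⊗ D : A ⊗ A → A ⊗ A ⊗ A` for `D : A → A ⊗ A`. -/
noncomputable def coRight (D : A →ₗ[K] A ⊗[K] A) : A ⊗[K] A →ₗ[K] A ⊗[K] (A ⊗[K] A) :=
  TensorProduct.map LinearMap.id D

/-- `D ⊗ id : A ⊗ A → A ⊗ A ⊗ A` for `D : A → A ⊗ A`. -/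
noncomputable def coLeft (D : A →ₗ[K] A ⊗[K] A) : A ⊗[K] A →ₗ[K] A ⊗[K] (A ⊗[K] A) :=
  (TensorProduct.assoc K A A A).toLinearMap ∘ₗ TensorProduct.map D LinearMap.id

/-- `τ ⊗ id` on `A ⊗ A ⊗ A`. -/
noncomputable def swapLeft : A ⊗[K] (A ⊗[K] A) →ₗ[K] A ⊗[K] (A ⊗[K] A) :=
  (TensorProduct.leftComm K A A A).toLinearMap

/-- The linear map `(a ⊗ b) ⊗ (a' ⊗ b') ↦ (a ⋄ a') ⊗ b ⊗ b'`, sending `r ⊗ r` to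
`r₁₂ ⋄ r₁₃`. -/
noncomputable def legs₁₂₁₃ (m : A →ₗ[K] A →ₗ[K] A) :
    (A ⊗[K] A) ⊗[K] (A ⊗[K] A) →ₗ[K] A ⊗[K] (A ⊗[K] A) :=
  TensorProduct.map (TensorProduct.lift m) LinearMap.id ∘ₗ
    (TensorProduct.tensorTensorTensorComm K A A A A).toLinearMap

/-- The linear map `(a ⊗ b) ⊗ (a' ⊗ b') ↦ a ⊗ (b ⋄ a') ⊗ b'`, sending `r ⊗ r` to
`r₁₂ ⋄ r₂₃`. -/
noncomputable def legs₁₂₂₃ (m : A →ₗ[K] A →ₗ[K] A) :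
    (A ⊗[K] A) ⊗[K] (A ⊗[K] A) →ₗ[K] A ⊗[K] (A ⊗[K] A) :=
  TensorProduct.map LinearMap.id
      (TensorProduct.map (TensorProduct.lift m) LinearMap.id ∘ₗ
        (TensorProduct.assoc K A A A).symm.toLinearMap) ∘ₗ
    (TensorProduct.assoc K A A (A ⊗[K] A)).toLinearMap

/-- The linear map `(a ⊗ b) ⊗ (a' ⊗ b') ↦ a ⊗ a' ⊗ (b ⋄ b')`, sending `r ⊗ r` to
`r₁₃ ⋄ r₂₃`. -/
noncomputable def legs₁₃₂₃ (m : A →ₗ[K] A →ₗ[K] A) :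
    (A ⊗[K] A) ⊗[K] (A ⊗[K] A) →ₗ[K] A ⊗[K] (A ⊗[K] A) :=
  (TensorProduct.assoc K A A A).toLinearMap ∘ₗ
    TensorProduct.map LinearMap.id (TensorProduct.lift m) ∘ₗ
      (TensorProduct.tensorTensorTensorComm K A A A A).toLinearMap

theorem legs₁₂₁₃_tmul (m : A →ₗ[K] A →ₗ[K] A) (a b a' b' : A) :
    legs₁₂₁₃ m ((a ⊗ₜ b) ⊗ₜ (a' ⊗ₜ b')) = m a a' ⊗ₜ (b ⊗ₜ b') := rfl

theorem legs₁₂₂₃_tmul (m : A →ₗ[K] A →ₗ[K] A) (a b a' b' : A) :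
    legs₁₂₂₃ m ((a ⊗ₜ b) ⊗ₜ (a' ⊗ₜ b')) = a ⊗ₜ (m b a' ⊗ₜ b') := rfl

theorem legs₁₃₂₃_tmul (m : A →ₗ[K] A →ₗ[K] A) (a b a' b' : A) :
    legs₁₃₂₃ m ((a ⊗ₜ b) ⊗ₜ (a' ⊗ₜ b')) = a ⊗ₜ (a' ⊗ₜ m b b') := rfl

/-- The associative Yang-Baxter equation `r₁₂ · r₁₃ - r₁₂ · r₂₃ + r₁₃ · r₂₃ = 0`. -/
def AYBE (mul : A →ₗ[K] A →ₗ[K] A) (r : A ⊗[K] A) : Prop :=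
  legs₁₂₁₃ mul (r ⊗ₜ r) - legs₁₂₂₃ mul (r ⊗ₜ r) + legs₁₃₂₃ mul (r ⊗ₜ r) = 0

/-- The classical Yang-Baxter equation `[r₁₂, r₁₃] + [r₁₂, r₂₃] + [r₁₃, r₂₃] = 0`. -/
def CYBE (br : A →ₗ[K] A →ₗ[K] A) (r : A ⊗[K] A) : Prop :=
  legs₁₂₁₃ br (r ⊗ₜ r) + legs₁₂₂₃ br (r ⊗ₜ r) + legs₁₃₂₃ br (r ⊗ₜ r) = 0

/-- `r` is a solution of the relative Poisson Yang-Baxter equation associated to `Q`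
(the `Q`-RPYBE) in `(A, ·, [-,-], P)`. -/
structure IsRPYBESolution (mul br : A →ₗ[K] A →ₗ[K] A) (P Q : A →ₗ[K] A)
    (r : A ⊗[K] A) : Prop where
  aybe : AYBE mul r
  cybe : CYBE br r
  eq₁ : onLeft P r - onRight Q r = 0
  eq₂ : onLeft Q r - onRight P r = 0

/-- The tensor `r` is antisymmetric. -/
def IsAntisymmetric (r : A ⊗[K] A) : Prop := r + swap r = 0

/-- `Δ(x) = (id ⊗ 𝓛(x) - 𝓛(x) ⊗ id) r`. -/
noncomputable def coboundaryMul (mul : A →ₗ[K] A →ₗ[K] A) (r : A ⊗[K] A) :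
    A →ₗ[K] A ⊗[K] A where
  toFun x := onRight (mul x) r - onLeft (mul x) r
  map_add' x y := by
    simp only [map_add, TensorProduct.map_add_left, TensorProduct.map_add_right,
      LinearMap.add_apply]
    abel
  map_smul' c x := by
    simp only [map_smul, TensorProduct.map_smul_left, TensorProduct.map_smul_right,
      LinearMap.smul_apply, smul_sub, RingHom.id_apply]

/-- `δ(x) = (ad(x) ⊗ id + id ⊗ ad(x)) r`. -/
noncomputable def coboundaryBr (br : A →ₗ[K] A →ₗ[K] A) (r : A ⊗[K] A) :
    A →ₗ[K] A ⊗[K] A where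
  toFun x := onLeft (br x) r + onRight (br x) r
  map_add' x y := by
    simp only [map_add, TensorProduct.map_add_left, TensorProduct.map_add_right,
      LinearMap.add_apply]
    abel
  map_smul' c x := by
    simp only [map_smul, TensorProduct.map_smul_left, TensorProduct.map_smul_right,
      LinearMap.smul_apply, smul_add, RingHom.id_apply]

/-- `(A, Δ, δ, Q)` is a relative Poisson coalgebra. -/
structure IsRelativePoissonCoalgebra (Δ δ : A →ₗ[K] A ⊗[K] A) (Q : A →ₗ[K] A) : Prop where
  cocomm : ∀ x, swap (Δ x) = Δ x
  coassoc : ∀ x, coRight Δ (Δ x) = coLeft Δ (Δ x)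
  skew : ∀ x, swap (δ x) = -δ x
  cojacobi : ∀ x,
    coRight δ (δ x) + cyc (coRight δ (δ x)) + cyc (cyc (coRight δ (δ x))) = 0
  coderivation_Δ : ∀ x, Δ (Q x) = onLeft Q (Δ x) + onRight Q (Δ x)
  coderivation_δ : ∀ x, δ (Q x) = onLeft Q (δ x) + onRight Q (δ x)
  coleibniz : ∀ x,
    coRight Δ (δ x) - coLeft δ (Δ x) - swapLeft (coRight δ (Δ x))
      - TensorProduct.map Q LinearMap.id (coLeft Δ (Δ x)) = 0

/-- `(A, ·, [-,-], Δ, δ, P, Q)` is a relative Poisson bialgebra. -/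
structure IsRelativePoissonBialgebra (mul br : A →ₗ[K] A →ₗ[K] A)
    (Δ δ : A →ₗ[K] A ⊗[K] A) (P Q : A →ₗ[K] A) : Prop where
  algebra : IsRelativePoisson mul br P
  coalgebra : IsRelativePoissonCoalgebra Δ δ Q
  /-- `(A, ·, Δ)` is an infinitesimal bialgebra. -/
  infinitesimal : ∀ x y, Δ (mul x y) = onLeft (mul x) (Δ y) + onRight (mul y) (Δ x)
  /-- `(A, [-,-], δ)` is a Lie bialgebra. -/
  lieBialgebra : ∀ x y, δ (br x y) =
    (onLeft (br x) (δ y) + onRight (br x) (δ y)) - (onLeft (br y) (δ x) + onRight (br y) (δ x))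
  duallyRepresents : DuallyRepresents mul br P Q
  /-- This condition and the next two say that `P*` dually represents `(A*, Q*)`. -/
  dual_Δ : ∀ x, Δ (P x) = onLeft P (Δ x) - onRight Q (Δ x)
  dual_δ : ∀ x, δ (P x) = onLeft P (δ x) - onRight Q (δ x)
  dual_ΔΔ : ∀ x, coLeft Δ (Δ (P x + Q x)) = 0
  compat₁ : ∀ x y,
    δ (mul x y) - onRight (br y) (Δ x) - onLeft (mul x) (δ y)
      - onRight (br x) (Δ y) - onLeft (mul y) (δ x) - onRight Q (Δ (mul x y)) = 0
  compat₂ : ∀ x y,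
    Δ (br x y) - onLeft (mul y) (δ x) - onRight (br x) (Δ y)
      + onRight (mul y) (δ x) - onLeft (br x) (Δ y) + Δ (mul (P x) y) = 0

end Tensors

section Double

variable {K A A₁ A₂ : Type*} [Field K] [AddCommGroup A] [Module K A]
  [AddCommGroup A₁] [Module K A₁] [AddCommGroup A₂] [Module K A₂]

/-- The operation on `A*` dual to `D : A → A ⊗ A`: `⟨a * b, x⟩ = ⟨a ⊗ b, D(x)⟩`. -/
noncomputable def dualOp (D : A →ₗ[K] A ⊗[K] A) :
    Module.Dual K A →ₗ[K] Module.Dual K A →ₗ[K] Module.Dual K A :=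
  TensorProduct.curry (D.dualMap ∘ₗ TensorProduct.dualDistrib K A A)

theorem dualOp_apply (D : A →ₗ[K] A ⊗[K] A) (a b : Module.Dual K A) (x : A) :
    dualOp D a b x = TensorProduct.dualDistrib K A A (a ⊗ₜ b) (D x) := rfl

/-- The product
`(x + a) · (y + b) = x · y + μ₂(a) y + μ₂(b) x + a · b + μ₁(x) b + μ₁(y) a` on `A₁ ⊕ A₂`. -/
def bowtieMul (mul₁ : A₁ →ₗ[K] A₁ →ₗ[K] A₁) (mul₂ : A₂ →ₗ[K] A₂ →ₗ[K] A₂)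
    (μ₁ : A₁ →ₗ[K] Module.End K A₂) (μ₂ : A₂ →ₗ[K] Module.End K A₁) :
    (A₁ × A₂) →ₗ[K] (A₁ × A₂) →ₗ[K] (A₁ × A₂) :=
  LinearMap.mk₂ K
    (fun p q => (mul₁ p.1 q.1 + μ₂ p.2 q.1 + μ₂ q.2 p.1,
      mul₂ p.2 q.2 + μ₁ p.1 q.2 + μ₁ q.1 p.2))
    (fun p p' q => by ext <;> simp <;> abel)
    (fun c p q => by ext <;> simp)
    (fun p q q' => by ext <;> simp <;> abel)
    (fun c p q => by ext <;> simp)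

/-- The bracket
`[x + a, y + b] = [x, y] + ρ₂(a) y - ρ₂(b) x + [a, b] + ρ₁(x) b - ρ₁(y) a` on `A₁ ⊕ A₂`. -/
def bowtieBr (br₁ : A₁ →ₗ[K] A₁ →ₗ[K] A₁) (br₂ : A₂ →ₗ[K] A₂ →ₗ[K] A₂)
    (ρ₁ : A₁ →ₗ[K] Module.End K A₂) (ρ₂ : A₂ →ₗ[K] Module.End K A₁) :
    (A₁ × A₂) →ₗ[K] (A₁ × A₂) →ₗ[K] (A₁ × A₂) :=
  LinearMap.mk₂ K
    (fun p q => (br₁ p.1 q.1 + ρ₂ p.2 q.1 - ρ₂ q.2 p.1,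
      br₂ p.2 q.2 + ρ₁ p.1 q.2 - ρ₁ q.1 p.2))
    (fun p p' q => by ext <;> simp <;> abel)
    (fun c p q => by ext <;> simp [smul_sub])
    (fun p q q' => by ext <;> simp <;> abel)
    (fun c p q => by ext <;> simp [smul_sub])

/-- The action of `(A*, m*)` on `A` dual to its left multiplication, under the identification
`A = A**` for finite-dimensional `A`: `⟨(L_{m*})*(a) x, b⟩ = -⟨x, m*(a, b)⟩`. -/
noncomputable def codualRep [FiniteDimensional K A]
    (m : Module.Dual K A →ₗ[K] Module.Dual K A →ₗ[K] Module.Dual K A) :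
    Module.Dual K A →ₗ[K] Module.End K A :=
  (Module.evalEquiv K A).symm.conj.toLinearMap ∘ₗ dualRep m

/-- The product on `A ⋈ A*`, the direct sum `A ⊕ A*` with `A*` carrying the product dual to
`Δ` and with the mutual actions `-𝓛_A*` and `-𝓛_{A*}*`. -/
noncomputable def doubleMul [FiniteDimensional K A] (mul : A →ₗ[K] A →ₗ[K] A)
    (Δ : A →ₗ[K] A ⊗[K] A) :
    (A × Module.Dual K A) →ₗ[K] (A × Module.Dual K A) →ₗ[K] (A × Module.Dual K A) :=
  bowtieMul mul (dualOp Δ) (-dualRep mul) (-codualRep (dualOp Δ))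

/-- The bracket on `A ⋈ A*`, the direct sum `A ⊕ A*` with `A*` carrying the bracket dual to
`δ` and with the mutual actions `ad_A*` and `ad_{A*}*`. -/
noncomputable def doubleBr [FiniteDimensional K A] (br : A →ₗ[K] A →ₗ[K] A)
    (δ : A →ₗ[K] A ⊗[K] A) :
    (A × Module.Dual K A) →ₗ[K] (A × Module.Dual K A) →ₗ[K] (A × Module.Dual K A) :=
  bowtieBr br (dualOp δ) (dualRep br) (codualRep (dualOp δ))

/-- The map `P + Q*` on `A ⋈ A*`. -/
noncomputable def doubleP (P Q : A →ₗ[K] A) :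
    (A × Module.Dual K A) →ₗ[K] (A × Module.Dual K A) :=
  P.prodMap Q.dualMap

/-- The bilinear form `𝓑_d(x + a, y + b) = ⟨x, b⟩ + ⟨a, y⟩` on `A ⊕ A*`. -/
def doubleForm (K A : Type*) [Field K] [AddCommGroup A] [Module K A] :
    LinearMap.BilinForm K (A × Module.Dual K A) :=
  LinearMap.mk₂ K (fun p q => q.2 p.1 + p.2 q.1)
    (fun p p' q => by simp; ring)
    (fun c p q => by simp; ring)
    (fun p q q' => by simp; ring)
    (fun c p q => by simp; ring)

/-- The defining property of `codualRep`. -/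
theorem apply_codualRep [FiniteDimensional K A]
    (m : Module.Dual K A →ₗ[K] Module.Dual K A →ₗ[K] Module.Dual K A)
    (a b : Module.Dual K A) (x : A) : b (codualRep m a x) = -(m a b) x := by
  have h : Module.evalEquiv K A (codualRep m a x)
      = dualRep m a (Module.evalEquiv K A x) := by
    simp [codualRep, LinearEquiv.conj_apply]
  simpa [dualRep_apply] using LinearMap.congr_fun h b

end Double

end RelativePoisson

open RelativePoisson

namespace RelativePoisson

/-! ### Relative Poisson algebras: semi-direct products, dual representations, unital extension. -/

section Algebras

variable {K A V : Type*} [Field K] [AddCommGroup A] [Module K A] [AddCommGroup V] [Module K V]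
  {mul br : A →ₗ[K] A →ₗ[K] A} {P : A →ₗ[K] A}

/-! Write X for `Ã ⋉ A*`. The pre-Poisson axioms enter only in showing that X is relative Poisson:
they make `⋆` and `∘`, extended to e by `id` and `P`, satisfy the conditions under which their duals
represent `Ã` on `A*` (`isRepresentation_neg_dualRep`).

An antisymmetric tensor r is a skew map X* → X, namely `contract r`. In these terms the two
Yang-Baxter equations become trilinear scalar identities (`aybe_iff`, `cybe_iff`), which say that
`contract r` is a homomorphism from X* with the dual operations to X. For the canonical tensor they
hold by formal cancellation, since the operations of A symmetrize `⋆` and antisymmetrize `∘`.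

The main device is the map (x, a) ↦ (x + r(a), a). It carries the double of the coboundary bialgebra
injectively and homomorphically into the semi-direct product of X with its coadjoint representation,
which is relative Poisson because the negative of the derivation always dually represents. Hence the
axioms of the double need no direct verification, and those of the coalgebra follow because X* is a
subalgebra of the double. The remaining bialgebra identities are operator identities in X applied to
the legs of r.

The same map shows that e is a unit of the double and that bracketing with e is its derivation, so
the double is Jacobi. The pairing is invariant because the mixed actions are defined as adjoints. -/

@[simp]
theorem semidirectMul_apply (mul : A →ₗ[K] A →ₗ[K] A) (μ : A →ₗ[K] Module.End K V)
    (p q : A × V) : semidirectMul mul μ p q = (mul p.1 q.1, μ p.1 q.2 + μ q.1 p.2) := rfl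

@[simp]
theorem semidirectBr_apply (br : A →ₗ[K] A →ₗ[K] A) (ρ : A →ₗ[K] Module.End K V)
    (p q : A × V) : semidirectBr br ρ p q = (br p.1 q.1, ρ p.1 q.2 - ρ q.1 p.2) := rfl

@[simp]
theorem extMul_apply (mul : A →ₗ[K] A →ₗ[K] A) (p q : A × K) :
    extMul mul p q = (mul p.1 q.1 + p.2 • q.1 + q.2 • p.1, p.2 * q.2) := rfl

@[simp]
theorem extBr_apply (br : A →ₗ[K] A →ₗ[K] A) (P : A →ₗ[K] A) (p q : A × K) :
    extBr br P p q = (br p.1 q.1 + p.2 • P q.1 - q.2 • P p.1, 0) := rfl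

@[simp]
theorem extP_apply (P : A →ₗ[K] A) (p : A × K) : extP P p = (P p.1, 0) := rfl

@[simp]
theorem extRep_apply (φ : A →ₗ[K] Module.End K V) (α : Module.End K V) (p : A × K) (v : V) :
    extRep φ α p v = φ p.1 v + p.2 • α v := rfl

@[simp]
theorem subMul_apply (star : A →ₗ[K] A →ₗ[K] A) (x y : A) :
    subMul star x y = star x y + star y x := rfl

@[simp]
theorem subBr_apply (circ : A →ₗ[K] A →ₗ[K] A) (x y : A) :
    subBr circ x y = circ x y - circ y x := rfl

theorem IsLie.skew (h : IsLie br) (x y : A) : br x y = -br y x := by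
  have := h.self (x + y)
  simp only [map_add, LinearMap.add_apply, h.self, zero_add, add_zero] at this
  exact eq_neg_of_add_eq_zero_right this

theorem IsLie.leibniz (h : IsLie br) (x y z : A) :
    br (br x y) z = br x (br y z) - br y (br x z) := by
  have := h.jacobi x y z
  rw [h.skew z x, h.skew z (br x y), map_neg] at this
  linear_combination (norm := abel) -this

theorem IsUnitElement.unique {e e' : A} (h : IsUnitElement mul e) (h' : IsUnitElement mul e') :
    e' = e := by
  rw [← (h e').1, (h' e).2]

/-- The semi-direct product of a relative Poisson algebra with a representation. -/
theorem IsRepresentation.isRelativePoisson_semidirect {μ ρ : A →ₗ[K] Module.End K V}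
    {α : V →ₗ[K] V} (hA : IsRelativePoisson mul br P)
    (h : IsRepresentation mul br P μ ρ α) :
    IsRelativePoisson (semidirectMul mul μ) (semidirectBr br ρ) (P.prodMap α) where
  commAssoc :=
    { comm := fun x y => Prod.ext (hA.commAssoc.comm _ _) (add_comm _ _)
      assoc := fun x y z => by
        refine Prod.ext (hA.commAssoc.assoc _ _ _) ?_
        -- Commutativity of the algebra makes the operators `μ` commute with each other.
        have e₁ := h.rep_mul x.1 z.1 y.2
        rw [hA.commAssoc.comm, h.rep_mul] at e₁
        have e₂ := h.rep_mul y.1 z.1 x.2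
        rw [hA.commAssoc.comm, h.rep_mul] at e₂
        simp only [semidirectMul_apply, map_add, h.rep_mul, e₁, e₂]
        abel }
  lie :=
    { self := fun x => Prod.ext (hA.lie.self _) (sub_self _)
      jacobi := fun x y z => by
        refine Prod.ext (hA.lie.jacobi _ _ _) ?_
        simp only [semidirectBr_apply, map_sub, h.rep_br, Prod.snd_add, Prod.snd_zero]
        abel }
  derivation_mul := fun x y => by
    refine Prod.ext (hA.derivation_mul _ _) ?_
    have e₁ := h.map_mul x.1 y.2
    have e₂ := h.map_mul y.1 x.2
    simp only [semidirectMul_apply, LinearMap.prodMap_apply, Prod.snd_add, map_add]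
    linear_combination (norm := abel) e₁ + e₂
  derivation_br := fun x y => by
    refine Prod.ext (hA.derivation_br _ _) ?_
    have e₁ := h.map_br x.1 y.2
    have e₂ := h.map_br y.1 x.2
    simp only [semidirectBr_apply, LinearMap.prodMap_apply, Prod.snd_add, map_sub]
    linear_combination (norm := abel) e₁ - e₂
  leibniz := fun x y z => by
    refine Prod.ext (hA.leibniz _ _ _) ?_
    have e₁ := h.compatible x.1 z.1 y.2
    have e₂ := h.compatible y.1 z.1 x.2
    have e₃ := h.leibniz x.1 y.1 z.2
    have e₄ := h.rep_mul (P z.1) x.1 y.2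
    have e₅ := h.rep_mul (P z.1) y.1 x.2
    rw [hA.commAssoc.comm] at e₄ e₅
    rw [hA.lie.skew] at e₁ e₂
    simp only [semidirectMul_apply, semidirectBr_apply, LinearMap.prodMap_apply, Prod.snd_add,
      map_add, map_sub, map_neg, LinearMap.neg_apply] at *
    linear_combination (norm := abel) e₁ + e₂ - e₃ + e₄ + e₅

/-- The dual of a map with the properties below is a representation. -/
theorem isRepresentation_neg_dualRep {μ ρ : A →ₗ[K] Module.End K V} {β : V →ₗ[K] V}
    (hmul : ∀ x y v, μ (mul x y) v = μ y (μ x v))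
    (hunit : ∀ e, IsUnitElement mul e → ∀ v, μ e v = v)
    (hbr : ∀ x y v, ρ (br x y) v = ρ x (ρ y v) - ρ y (ρ x v))
    (hcomp : ∀ x y v, ρ y (μ x v) - μ x (ρ y v) + μ (br x y) v - μ (mul x (P y)) v = 0)
    (hβμ : ∀ x v, μ x (β v) - μ (P x) v - β (μ x v) = 0)
    (hβρ : ∀ x v, ρ x (β v) - ρ (P x) v - β (ρ x v) = 0)
    (hleib : ∀ x y v,
      ρ y (μ x v) + ρ x (μ y v) - ρ (mul x y) v + β (μ (mul x y) v) = 0) :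
    IsRepresentation mul br P (-dualRep μ) (dualRep ρ) β.dualMap := by
  have e₁ : ∀ x (u : Module.Dual K V) v, (-dualRep μ) x u v = u (μ x v) := fun x u v => by
    simp [dualRep_apply]
  have e₃ : ∀ (u : Module.Dual K V) v, β.dualMap u v = u (β v) := fun u v => rfl
  constructor
  · intro x y u
    ext v
    simp only [e₁, hmul]
  · intro e he u
    ext v
    simp only [e₁, hunit e he]
  · intro x y u
    ext v
    simp only [dualRep_apply, LinearMap.sub_apply, hbr, map_sub]
    ring
  · intro x y u
    ext v
    have := congrArg u (hcomp x y v)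
    simp only [e₁, dualRep_apply, LinearMap.sub_apply, LinearMap.add_apply, LinearMap.zero_apply,
      map_sub, map_add, map_zero] at this ⊢
    linear_combination this
  · intro x u
    ext v
    have := congrArg u (hβμ x v)
    simp only [e₁, e₃, LinearMap.sub_apply, LinearMap.zero_apply, map_sub, map_zero] at this ⊢
    linear_combination this
  · intro x u
    ext v
    have := congrArg u (hβρ x v)
    simp only [dualRep_apply, e₃, LinearMap.sub_apply, LinearMap.zero_apply, map_sub,
      map_zero] at this ⊢
    linear_combination -this
  · intro x y u
    ext v
    have := congrArg u (hleib x y v)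
    simp only [e₁, e₃, dualRep_apply, LinearMap.sub_apply, LinearMap.add_apply,
      LinearMap.zero_apply, map_sub, map_add, map_zero] at this ⊢
    linear_combination this

/-- The bracket of a product in the first argument. -/
theorem IsRelativePoisson.leibniz_left (h : IsRelativePoisson mul br P) (x y z : A) :
    br (mul x y) z = mul x (br y z) + mul y (br x z) - mul (mul x y) (P z) := by
  rw [h.lie.skew, h.leibniz, h.lie.skew z x, h.lie.skew z y, h.commAssoc.comm _ y]
  simp only [map_neg]
  abel

/-- The cyclic sum of brackets of an element with a product. -/
theorem IsRelativePoisson.cyclic_leibniz (h : IsRelativePoisson mul br P) (x y z : A) :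
    br y (mul x z) + br x (mul y z) - br (mul x y) z - P (mul (mul x y) z) = 0 := by
  rw [h.leibniz_left, h.leibniz x z y, h.leibniz y z x, h.derivation_mul, h.derivation_mul,
    h.lie.skew y x]
  have e₁ : mul (mul x z) (P y) = mul (mul x (P y)) z := by
    rw [h.commAssoc.assoc, h.commAssoc.comm z, h.commAssoc.assoc]
  have e₂ : mul (mul y z) (P x) = mul (mul (P x) y) z := by
    rw [h.commAssoc.comm _ (P x), h.commAssoc.assoc]
  rw [e₁, e₂]
  simp only [map_add, map_neg, LinearMap.add_apply, LinearMap.neg_apply]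
  abel

/-- The map `-P` dually represents a relative Poisson algebra. -/
theorem IsRelativePoisson.duallyRepresents_neg (h : IsRelativePoisson mul br P) :
    DuallyRepresents mul br P (-P) := by
  apply isRepresentation_neg_dualRep
  · intro x y v
    rw [h.commAssoc.comm x, h.commAssoc.assoc]
  · exact fun e he v => (he v).1
  · exact h.lie.leibniz
  · intro x y v
    have e : mul (mul x (P y)) v = mul (mul x v) (P y) := by
      rw [h.commAssoc.assoc, h.commAssoc.comm (P y), h.commAssoc.assoc]
    rw [h.leibniz, h.lie.skew x y, e]
    simp only [map_neg, LinearMap.neg_apply]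
    abel
  · intro x v
    simp only [LinearMap.neg_apply, map_neg, h.derivation_mul x v]
    abel
  · intro x v
    simp only [LinearMap.neg_apply, map_neg, h.derivation_br x v]
    abel
  -- With `-P` in place of `β`, the last condition is the cyclic form of the Leibniz rule.
  · intro x y v
    have := h.cyclic_leibniz x y v
    simp only [LinearMap.neg_apply]
    linear_combination (norm := abel) this

theorem IsRelativePoisson.isJacobi {e : A} (h : IsRelativePoisson mul br P)
    (he : IsUnitElement mul e) (hP : ∀ x, br e x = P x) : IsJacobi mul br e where
  commAssoc := h.commAssoc
  isUnit := he
  lie := h.lie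
  leibniz x y z := by rw [hP, h.leibniz]

/-- Relative Poisson algebra structures are transported along injective homomorphisms. -/
theorem IsRelativePoisson.of_injective {mul' br' : V →ₗ[K] V →ₗ[K] V} {P' : V →ₗ[K] V}
    (h : IsRelativePoisson mul br P) (f : V →ₗ[K] A) (hf : Function.Injective f)
    (hmul : ∀ x y, f (mul' x y) = mul (f x) (f y)) (hbr : ∀ x y, f (br' x y) = br (f x) (f y))
    (hP : ∀ x, f (P' x) = P (f x)) : IsRelativePoisson mul' br' P' where
  commAssoc :=
    { comm := fun x y => hf (by simp only [hmul, h.commAssoc.comm (f x)])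
      assoc := fun x y z => hf (by simp only [hmul, h.commAssoc.assoc]) }
  lie :=
    { self := fun x => hf (by simp only [hbr, h.lie.self, map_zero])
      jacobi := fun x y z => hf (by simp only [map_add, hbr, h.lie.jacobi, map_zero]) }
  derivation_mul := fun x y => hf (by simp only [map_add, hmul, hP, h.derivation_mul (f x)])
  derivation_br := fun x y => hf (by simp only [map_add, hbr, hP, h.derivation_br (f x)])
  leibniz := fun x y z => hf (by simp only [map_add, hmul, hbr, hP, h.leibniz])

/-- The extension of a relative Poisson algebra by a unit. -/
theorem IsRelativePoisson.ext (h : IsRelativePoisson mul br P) :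
    IsRelativePoisson (extMul mul) (extBr br P) (extP P) where
  commAssoc :=
    { comm := fun x y => by
        refine Prod.ext ?_ (mul_comm _ _)
        simp only [extMul_apply, h.commAssoc.comm x.1]
        abel
      assoc := fun x y z => by
        refine Prod.ext ?_ (mul_assoc _ _ _)
        simp only [extMul_apply, map_add, map_smul, LinearMap.add_apply, LinearMap.smul_apply,
          h.commAssoc.assoc]
        module }
  lie :=
    { self := fun x => by
        refine Prod.ext ?_ rfl
        simp [h.lie.self]
      jacobi := fun x y z => by
        refine Prod.ext ?_ (by simp)
        have e₁ := h.derivation_br x.1 y.1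
        have e₂ := h.derivation_br y.1 z.1
        have e₃ := h.derivation_br z.1 x.1
        have e₄ := h.lie.jacobi x.1 y.1 z.1
        rw [h.lie.skew (P x.1)] at e₁
        rw [h.lie.skew (P y.1)] at e₂
        rw [h.lie.skew (P z.1)] at e₃
        simp only [extBr_apply, map_add, map_sub, map_smul, Prod.fst_add, Prod.fst_zero]
        linear_combination (norm := module) e₄ + z.2 • e₁ + x.2 • e₂ + y.2 • e₃ }
  derivation_mul := fun x y => by
    refine Prod.ext ?_ (by simp)
    simp only [extMul_apply, extP_apply, map_add, map_smul, Prod.fst_add, h.derivation_mul x.1]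
    module
  derivation_br := fun x y => by
    refine Prod.ext ?_ (by simp)
    simp only [extBr_apply, extP_apply, map_add, map_sub, map_smul, Prod.fst_add,
      h.derivation_br x.1]
    module
  leibniz := fun x y z => by
    refine Prod.ext ?_ (by simp)
    have e := h.leibniz x.1 y.1 z.1
    have e₁ := h.derivation_mul x.1 y.1
    simp only [extMul_apply, extBr_apply, extP_apply, map_add, map_sub, map_smul, Prod.fst_add,
      LinearMap.add_apply, LinearMap.sub_apply, LinearMap.smul_apply]
    linear_combination (norm := module) e + z.2 • e₁ + x.2 • h.commAssoc.comm (P z.1) y.1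

theorem isUnitElement_ext (mul : A →ₗ[K] A →ₗ[K] A) :
    IsUnitElement (extMul mul) ((0, 1) : A × K) := fun x => by
  constructor <;> ext <;> simp

theorem extBr_unit (br : A →ₗ[K] A →ₗ[K] A) (P : A →ₗ[K] A) (x : A × K) :
    extBr br P (0, 1) x = extP P x := by
  ext <;> simp

end Algebras

/-! ### Sub-adjacent algebra of a relative pre-Poisson algebra and its action on the dual space. -/

section PrePoisson

variable {K A : Type*} [Field K] [AddCommGroup A] [Module K A]
  {star circ : A →ₗ[K] A →ₗ[K] A} {P : A →ₗ[K] A}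

/-- The right side of the Zinbiel identity is symmetric in `x` and `y`. -/
theorem IsRelativePrePoisson.star_star (h : IsRelativePrePoisson star circ P) (x y z : A) :
    star x (star y z) = star y (star x z) := by
  rw [h.zinbiel, h.zinbiel, add_comm]

/-- The sub-adjacent relative Poisson algebra. -/
theorem IsRelativePrePoisson.isRelativePoisson (h : IsRelativePrePoisson star circ P) :
    IsRelativePoisson (subMul star) (subBr circ) P where
  commAssoc :=
    { comm := fun x y => add_comm _ _
      assoc := fun x y z => by
        have e₁ := h.zinbiel x y z
        have e₂ := h.zinbiel z y x
        have e₃ := h.star_star x z y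
        simp only [subMul_apply, map_add, LinearMap.add_apply]
        linear_combination (norm := abel) e₂ - e₁ - e₃ }
  lie :=
    { self := fun x => sub_self _
      jacobi := fun x y z => by
        have e₁ := h.preLie x y z
        have e₂ := h.preLie y z x
        have e₃ := h.preLie z x y
        simp only [subBr_apply, map_sub]
        linear_combination (norm := abel) -e₁ - e₂ - e₃ }
  derivation_mul := fun x y => by
    simp only [subMul_apply, map_add, h.derivation_star x, h.derivation_star y]
    abel
  derivation_br := fun x y => by
    simp only [subBr_apply, map_sub, h.derivation_circ x, h.derivation_circ y]
    abel
  leibniz := fun x y z => by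
    -- `compat₁` treats `(x · y) ∘ z`, and `compat₂` treats `z ∘ (x ⋆ y)` and `z ∘ (y ⋆ x)`. The
    -- terms of `compat₂` that contain `P z` form `P z ⋆ (x · y)` by the Zinbiel identity.
    have e₁ := h.compat₁ x y z
    have e₂ := h.compat₂ x z y
    have e₃ := h.compat₂ y z x
    have e₄ := h.zinbiel (P z) x y
    have e₅ := h.zinbiel (P z) y x
    simp only [subMul_apply, subBr_apply, map_add, map_sub, LinearMap.add_apply,
      LinearMap.sub_apply] at *
    linear_combination (norm := abel) e₂ + e₃ - e₁ - e₄ - e₅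

/-- The representation of the extended Jacobi algebra on `A*`. -/
theorem IsRelativePrePoisson.isRepresentation (h : IsRelativePrePoisson star circ P) :
    IsRepresentation (extMul (subMul star)) (extBr (subBr circ) P) (extP P)
      (-dualRep (extRep star LinearMap.id)) (dualRep (extRep circ P)) (-P.dualMap) := by
  have hP : -P.dualMap = (-P).dualMap := by ext; simp
  rw [hP]
  apply isRepresentation_neg_dualRep
  · intro x y v
    have e₁ := h.zinbiel y.1 x.1 v
    simp only [extMul_apply, extRep_apply, subMul_apply, map_add, map_smul, LinearMap.add_apply,
      LinearMap.smul_apply, LinearMap.id_apply]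
    linear_combination (norm := module) -e₁
  · intro e he v
    rw [(isUnitElement_ext (subMul star)).unique he]
    simp
  · intro x y v
    have e₁ := h.preLie x.1 y.1 v
    have e₂ := h.derivation_circ x.1 v
    have e₃ := h.derivation_circ y.1 v
    simp only [extBr_apply, extRep_apply, subBr_apply, map_add, map_sub, map_smul,
      LinearMap.add_apply, LinearMap.sub_apply, LinearMap.smul_apply]
    linear_combination (norm := module) e₁ + y.2 • e₂ - x.2 • e₃
  · intro x y v
    have e₁ := h.compat₂ x.1 y.1 v
    have e₂ := h.derivation_star x.1 v
    simp only [extMul_apply, extBr_apply, extP_apply, extRep_apply, subBr_apply, subMul_apply,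
      map_add, map_sub, map_smul, LinearMap.add_apply, LinearMap.sub_apply,
      LinearMap.smul_apply, LinearMap.id_apply] at *
    linear_combination (norm := module) e₁ + y.2 • e₂
  · intro x v
    have e := h.derivation_star x.1 v
    simp only [extP_apply, extRep_apply, map_add, map_neg, map_smul, LinearMap.neg_apply,
      LinearMap.id_apply]
    linear_combination (norm := module) e
  · intro x v
    have e := h.derivation_circ x.1 v
    simp only [extP_apply, extRep_apply, map_add, map_neg, map_smul, LinearMap.neg_apply]
    linear_combination (norm := module) e
  · intro x y v
    -- In the sum of the two instances of `compat₂` the bracket terms cancel and the last terms give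
    -- `P (x · y) ⋆ v`. With `(x · y) ⋆ P v` from `compat₁` this is `P ((x · y) ⋆ v)`.
    have e₁ := h.compat₁ x.1 y.1 v
    have e₂ := h.compat₂ x.1 y.1 v
    have e₃ := h.compat₂ y.1 x.1 v
    have e₄ := h.derivation_star (star x.1 y.1) v
    have e₅ := h.derivation_star (star y.1 x.1) v
    rw [h.derivation_star x.1 y.1] at e₄
    rw [h.derivation_star y.1 x.1] at e₅
    simp only [extMul_apply, extRep_apply, subMul_apply,
      map_add, map_sub, map_smul, LinearMap.add_apply, LinearMap.sub_apply, LinearMap.neg_apply,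
      LinearMap.smul_apply, LinearMap.id_apply] at *
    linear_combination (norm := module) e₂ + e₃ - e₁ - e₄ - e₅

end PrePoisson

/-! ### Tensors as maps from the dual space; Yang-Baxter equations as scalar identities. -/

section Contraction

variable {K A : Type*} [Field K] [AddCommGroup A] [Module K A]

/-- The map `A* → A`, `a ↦ (a ⊗ id) r`, attached to a tensor `r`. -/
noncomputable def contract : A ⊗[K] A →ₗ[K] Module.Dual K A →ₗ[K] A :=
  dualTensorHom K (Module.Dual K A) A ∘ₗ
    TensorProduct.map (Module.Dual.eval K A) LinearMap.id

@[simp]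
theorem contract_tmul (x y : A) (a : Module.Dual K A) : contract (x ⊗ₜ[K] y) a = a x • y := by
  simp [contract]

theorem dualDistrib_map (f g : A →ₗ[K] A) (a b : Module.Dual K A) (r : A ⊗[K] A) :
    TensorProduct.dualDistrib K A A (a ⊗ₜ b) (TensorProduct.map f g r)
      = b (g (contract r (a ∘ₗ f))) := by
  induction r with
  | zero => simp
  | tmul x y => simp
  | add r s hr hs => simp only [map_add, LinearMap.add_apply, hr, hs]

theorem contract_map (f g : A →ₗ[K] A) (a : Module.Dual K A) (r : A ⊗[K] A) :
    contract (TensorProduct.map f g r) a = g (contract r (a ∘ₗ f)) := by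
  induction r with
  | zero => simp
  | tmul x y => simp
  | add r s hr hs => simp only [map_add, LinearMap.add_apply, hr, hs]

/-- Exchanging the tensor factors transposes `contract r`, so antisymmetric tensors give skew maps.
-/
theorem apply_contract_swap (r : A ⊗[K] A) (a b : Module.Dual K A) :
    b (contract (swap r) a) = a (contract r b) := by
  induction r with
  | zero => simp
  | tmul x y => simp [mul_comm]
  | add r s hr hs => simp only [map_add, LinearMap.add_apply, hr, hs]

theorem IsAntisymmetric.swap_eq {r : A ⊗[K] A} (hr : IsAntisymmetric r) : swap r = -r :=
  (neg_eq_of_add_eq_zero_right hr).symm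

theorem IsAntisymmetric.apply_contract {r : A ⊗[K] A} (hr : IsAntisymmetric r)
    (a b : Module.Dual K A) : b (contract r a) = -a (contract r b) := by
  rw [← apply_contract_swap r a b, hr.swap_eq]
  simp

/-- The pairing of `a ⊗ b ⊗ c` with elements of `A ⊗ A ⊗ A`. -/
noncomputable def triplePairing (a b c : Module.Dual K A) :
    A ⊗[K] (A ⊗[K] A) →ₗ[K] K :=
  TensorProduct.dualDistrib K A (A ⊗[K] A) (a ⊗ₜ TensorProduct.dualDistrib K A A (b ⊗ₜ c))

@[simp]
theorem triplePairing_tmul (a b c : Module.Dual K A) (x : A) (t : A ⊗[K] A) :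
    triplePairing a b c (x ⊗ₜ t) = a x * TensorProduct.dualDistrib K A A (b ⊗ₜ c) t := rfl

/-- In finite dimension every functional on `M ⊗ N` is a sum of functionals `a ⊗ b`, so these
separate points. -/
theorem eq_zero_of_dualDistrib {M N : Type*} [AddCommGroup M] [Module K M] [AddCommGroup N]
    [Module K N] [FiniteDimensional K M] [FiniteDimensional K N] {t : M ⊗[K] N}
    (h : ∀ a b, TensorProduct.dualDistrib K M N (a ⊗ₜ b) t = 0) : t = 0 := by
  rw [← Module.forall_dual_apply_eq_zero_iff K]
  intro f
  obtain ⟨s, rfl⟩ := (TensorProduct.dualDistribEquiv K M N).surjective f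
  change TensorProduct.dualDistrib K M N s t = 0
  induction s with
  | zero => simp
  | tmul a b => exact h a b
  | add s s' hs hs' => simp only [map_add, LinearMap.add_apply, hs, hs', add_zero]

theorem eq_zero_of_triplePairing [FiniteDimensional K A] {t : A ⊗[K] (A ⊗[K] A)}
    (h : ∀ a b c, triplePairing a b c t = 0) : t = 0 := by
  refine eq_zero_of_dualDistrib fun a f => ?_
  obtain ⟨s, rfl⟩ := (TensorProduct.dualDistribEquiv K A A).surjective f
  change TensorProduct.dualDistrib K A _ (a ⊗ₜ TensorProduct.dualDistrib K A A s) t = 0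
  induction s with
  | zero => simp
  | tmul b c => exact h a b c
  | add s s' hs hs' =>
    simp only [map_add, TensorProduct.tmul_add, LinearMap.add_apply, hs, hs', add_zero]

/-- The two legs that are not multiplied are absorbed by functionals. As `contract` evaluates on the
first factor, `swap` appears exactly when the factor to be multiplied is the first one. The same
rule governs the other two placements. -/
theorem triplePairing_legs₁₂₁₃ (m : A →ₗ[K] A →ₗ[K] A) (a b c : Module.Dual K A)
    (r s : A ⊗[K] A) : triplePairing a b c (legs₁₂₁₃ m (r ⊗ₜ s))
      = a (m (contract (swap r) b) (contract (swap s) c)) := by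
  induction r with
  | zero => simp
  | add r r' hr hr' =>
    simp only [map_add, TensorProduct.add_tmul, LinearMap.add_apply, hr, hr']
  | tmul x y =>
    induction s with
    | zero => simp
    | add s s' hs hs' =>
      simp only [map_add, TensorProduct.tmul_add, LinearMap.add_apply, hs, hs']
    | tmul x' y' =>
      simp [legs₁₂₁₃_tmul]
      ring

theorem triplePairing_legs₁₂₂₃ (m : A →ₗ[K] A →ₗ[K] A) (a b c : Module.Dual K A)
    (r s : A ⊗[K] A) : triplePairing a b c (legs₁₂₂₃ m (r ⊗ₜ s))
      = b (m (contract r a) (contract (swap s) c)) := by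
  induction r with
  | zero => simp
  | add r r' hr hr' =>
    simp only [map_add, TensorProduct.add_tmul, LinearMap.add_apply, hr, hr']
  | tmul x y =>
    induction s with
    | zero => simp
    | add s s' hs hs' =>
      simp only [map_add, TensorProduct.tmul_add, LinearMap.add_apply, hs, hs']
    | tmul x' y' =>
      simp [legs₁₂₂₃_tmul]
      ring

theorem triplePairing_legs₁₃₂₃ (m : A →ₗ[K] A →ₗ[K] A) (a b c : Module.Dual K A)
    (r s : A ⊗[K] A) : triplePairing a b c (legs₁₃₂₃ m (r ⊗ₜ s))
      = c (m (contract r a) (contract s b)) := by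
  induction r with
  | zero => simp
  | add r r' hr hr' =>
    simp only [map_add, TensorProduct.add_tmul, LinearMap.add_apply, hr, hr']
  | tmul x y =>
    induction s with
    | zero => simp
    | add s s' hs hs' =>
      simp only [map_add, TensorProduct.tmul_add, LinearMap.add_apply, hs, hs']
    | tmul x' y' =>
      simp [legs₁₃₂₃_tmul]
      ring

/-- Each `swap r` contributes a sign: two cancel in the `r₁₂ · r₁₃` term, and the single one in the
`r₁₂ · r₂₃` term turns its minus into a plus. -/
theorem IsAntisymmetric.aybe_iff [FiniteDimensional K A] {mul : A →ₗ[K] A →ₗ[K] A}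
    {r : A ⊗[K] A} (hr : IsAntisymmetric r) : AYBE mul r ↔ ∀ a b c : Module.Dual K A,
      a (mul (contract r b) (contract r c)) + b (mul (contract r a) (contract r c))
        + c (mul (contract r a) (contract r b)) = 0 := by
  have key : ∀ a b c : Module.Dual K A, triplePairing a b c
      (legs₁₂₁₃ mul (r ⊗ₜ r) - legs₁₂₂₃ mul (r ⊗ₜ r) + legs₁₃₂₃ mul (r ⊗ₜ r))
      = a (mul (contract r b) (contract r c)) + b (mul (contract r a) (contract r c))
        + c (mul (contract r a) (contract r b)) := fun a b c => by
    rw [map_add, map_sub, triplePairing_legs₁₂₁₃, triplePairing_legs₁₂₂₃,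
      triplePairing_legs₁₃₂₃, hr.swap_eq]
    simp
  refine ⟨fun h a b c => ?_, fun h => eq_zero_of_triplePairing fun a b c => ?_⟩
  · rw [← key, show _ = _ from h, map_zero]
  · rw [key, h]

theorem IsAntisymmetric.cybe_iff [FiniteDimensional K A] {br : A →ₗ[K] A →ₗ[K] A}
    {r : A ⊗[K] A} (hr : IsAntisymmetric r) : CYBE br r ↔ ∀ a b c : Module.Dual K A,
      a (br (contract r b) (contract r c)) - b (br (contract r a) (contract r c))
        + c (br (contract r a) (contract r b)) = 0 := by
  have key : ∀ a b c : Module.Dual K A, triplePairing a b c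
      (legs₁₂₁₃ br (r ⊗ₜ r) + legs₁₂₂₃ br (r ⊗ₜ r) + legs₁₃₂₃ br (r ⊗ₜ r))
      = a (br (contract r b) (contract r c)) - b (br (contract r a) (contract r c))
        + c (br (contract r a) (contract r b)) := fun a b c => by
    rw [map_add, map_add, triplePairing_legs₁₂₁₃, triplePairing_legs₁₂₂₃,
      triplePairing_legs₁₃₂₃, hr.swap_eq]
    simp [sub_eq_add_neg]
  refine ⟨fun h a b c => ?_, fun h => eq_zero_of_triplePairing fun a b c => ?_⟩
  · rw [← key, show _ = _ from h, map_zero]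
  · rw [key, h]

end Contraction

/-! ### Coalgebra axioms as algebra axioms on the dual space. -/

section Coalgebra

variable {K A : Type*} [Field K] [AddCommGroup A] [Module K A]

/-- Together with the pairings below, this turns an iterated coproduct into an iterated product on
`A*`. -/
theorem triplePairing_coRight (D : A →ₗ[K] A ⊗[K] A) (a b c : Module.Dual K A)
    (t : A ⊗[K] A) : triplePairing a b c (coRight D t)
      = TensorProduct.dualDistrib K A A (a ⊗ₜ dualOp D b c) t := by
  induction t with
  | zero => simp
  | tmul x y => rfl
  | add s t hs ht => simp only [map_add, hs, ht]

theorem triplePairing_assoc (a b c : Module.Dual K A) (s : A ⊗[K] A) (y : A) :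
    triplePairing a b c (TensorProduct.assoc K A A A (s ⊗ₜ y))
      = TensorProduct.dualDistrib K A A (a ⊗ₜ b) s * c y := by
  induction s with
  | zero => simp
  | tmul x z => simp [mul_assoc]
  | add s t hs ht => simp only [TensorProduct.add_tmul, map_add, hs, ht, add_mul]

theorem triplePairing_coLeft (D : A →ₗ[K] A ⊗[K] A) (a b c : Module.Dual K A)
    (t : A ⊗[K] A) : triplePairing a b c (coLeft D t)
      = TensorProduct.dualDistrib K A A (dualOp D a b ⊗ₜ c) t := by
  induction t with
  | zero => simp
  | tmul x y => exact triplePairing_assoc a b c (D x) y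
  | add s t hs ht => simp only [map_add, hs, ht]

theorem triplePairing_cyc (a b c : Module.Dual K A) (t : A ⊗[K] (A ⊗[K] A)) :
    triplePairing a b c (cyc t) = triplePairing c a b t := by
  induction t with
  | zero => simp
  | tmul x s =>
    refine (triplePairing_assoc a b c s x).trans ?_
    rw [triplePairing_tmul, mul_comm]
  | add s t hs ht => simp only [map_add, hs, ht]

theorem triplePairing_swapLeft (a b c : Module.Dual K A) (t : A ⊗[K] (A ⊗[K] A)) :
    triplePairing a b c (swapLeft t) = triplePairing b a c t := by
  induction t with
  | zero => simp
  | tmul x s =>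
    induction s with
    | zero => simp
    | tmul y z =>
      simp [swapLeft]
      ring
    | add s t hs ht => simp only [map_add, TensorProduct.tmul_add, hs, ht]
  | add s t hs ht => simp only [map_add, hs, ht]

theorem triplePairing_map_left (f : A →ₗ[K] A) (a b c : Module.Dual K A)
    (t : A ⊗[K] (A ⊗[K] A)) :
    triplePairing a b c (TensorProduct.map f LinearMap.id t)
      = triplePairing (f.dualMap a) b c t := by
  induction t with
  | zero => simp
  | tmul x s => rfl
  | add s t hs ht => simp only [map_add, hs, ht]

theorem dualDistrib_swap (a b : Module.Dual K A) (t : A ⊗[K] A) :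
    TensorProduct.dualDistrib K A A (a ⊗ₜ b) (swap t)
      = TensorProduct.dualDistrib K A A (b ⊗ₜ a) t := by
  induction t with
  | zero => simp
  | tmul x s => simp [mul_comm]
  | add s t hs ht => simp only [map_add, hs, ht]

theorem dualDistrib_map_dualMap (f g : A →ₗ[K] A) (a b : Module.Dual K A) (t : A ⊗[K] A) :
    TensorProduct.dualDistrib K A A (a ⊗ₜ b) (TensorProduct.map f g t)
      = TensorProduct.dualDistrib K A A (f.dualMap a ⊗ₜ g.dualMap b) t := by
  induction t with
  | zero => simp
  | tmul x s => simp
  | add s t hs ht => simp only [map_add, hs, ht]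

variable [FiniteDimensional K A]

/-- A relative Poisson algebra structure on `A*` dualizes to a coalgebra structure on `A`. -/
theorem IsRelativePoisson.isRelativePoissonCoalgebra {Δ δ : A →ₗ[K] A ⊗[K] A}
    {Q : A →ₗ[K] A} (h : IsRelativePoisson (dualOp Δ) (dualOp δ) Q.dualMap) :
    IsRelativePoissonCoalgebra Δ δ Q where
  cocomm x := by
    rw [← sub_eq_zero]
    refine eq_zero_of_dualDistrib fun a b => ?_
    rw [map_sub, dualDistrib_swap, ← dualOp_apply, ← dualOp_apply, h.commAssoc.comm, sub_self]
  coassoc x := by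
    rw [← sub_eq_zero]
    refine eq_zero_of_triplePairing fun a b c => ?_
    rw [map_sub, triplePairing_coRight, triplePairing_coLeft, ← dualOp_apply, ← dualOp_apply,
      h.commAssoc.assoc, sub_self]
  skew x := by
    rw [← sub_eq_zero]
    refine eq_zero_of_dualDistrib fun a b => ?_
    rw [map_sub, map_neg, dualDistrib_swap, ← dualOp_apply, ← dualOp_apply, h.lie.skew]
    simp
  cojacobi x := by
    refine eq_zero_of_triplePairing fun a b c => ?_
    simp only [map_add, triplePairing_cyc, triplePairing_coRight, ← dualOp_apply]
    have := LinearMap.congr_fun (h.lie.jacobi a b c) x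
    simp only [LinearMap.add_apply, LinearMap.zero_apply] at this
    linear_combination this
  coderivation_Δ x := by
    rw [← sub_eq_zero]
    refine eq_zero_of_dualDistrib fun a b => ?_
    have := LinearMap.congr_fun (h.derivation_mul a b) x
    simp only [map_sub, map_add, dualDistrib_map_dualMap, ← dualOp_apply]
    simp only [LinearMap.add_apply, LinearMap.dualMap_apply, LinearMap.dualMap_id,
      LinearMap.id_apply] at this ⊢
    linear_combination this
  coderivation_δ x := by
    rw [← sub_eq_zero]
    refine eq_zero_of_dualDistrib fun a b => ?_
    have := LinearMap.congr_fun (h.derivation_br a b) x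
    simp only [map_sub, map_add, dualDistrib_map_dualMap, ← dualOp_apply]
    simp only [LinearMap.add_apply, LinearMap.dualMap_apply, LinearMap.dualMap_id,
      LinearMap.id_apply] at this ⊢
    linear_combination this
  coleibniz x := by
    refine eq_zero_of_triplePairing fun a b c => ?_
    simp only [map_sub, triplePairing_map_left, triplePairing_swapLeft, triplePairing_coRight,
      triplePairing_coLeft, ← dualOp_apply]
    have := LinearMap.congr_fun (h.leibniz b c a) x
    -- The coalgebra axiom has `Q` on the first leg of the iterated coproduct, so it pairs to `(Q* a
    -- · b) · c`.
    rw [h.commAssoc.comm _ (Q.dualMap a), ← h.commAssoc.assoc] at this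
    simp only [LinearMap.add_apply] at this
    linear_combination this

end Coalgebra

/-! ### Dual operations of coboundary coproducts. -/

section Coboundary

variable {K A : Type*} [Field K] [AddCommGroup A] [Module K A]
  {mul br : A →ₗ[K] A →ₗ[K] A} {P : A →ₗ[K] A} {r : A ⊗[K] A}

theorem coboundaryMul_apply (mul : A →ₗ[K] A →ₗ[K] A) (r : A ⊗[K] A) (x : A) :
    coboundaryMul mul r x = onRight (mul x) r - onLeft (mul x) r := rfl

theorem coboundaryBr_apply (br : A →ₗ[K] A →ₗ[K] A) (r : A ⊗[K] A) (x : A) :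
    coboundaryBr br r x = onLeft (br x) r + onRight (br x) r := rfl

/-- For commutative `mul` this reads `a · b = -𝓛*(r(a)) b - 𝓛*(r(b)) a`; likewise the bracket below,
when skew, is `ad*(r(a)) b - ad*(r(b)) a`. -/
theorem IsAntisymmetric.dualOp_coboundaryMul (hr : IsAntisymmetric r)
    (a b : Module.Dual K A) (x : A) : dualOp (coboundaryMul mul r) a b x
      = b (mul x (contract r a)) + a (mul x (contract r b)) := by
  have := hr.apply_contract (a ∘ₗ mul x) b
  simp only [LinearMap.comp_apply] at this
  rw [dualOp_apply, coboundaryMul_apply, map_sub, dualDistrib_map, dualDistrib_map]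
  simp [this]

theorem IsAntisymmetric.dualOp_coboundaryBr (hr : IsAntisymmetric r)
    (a b : Module.Dual K A) (x : A) : dualOp (coboundaryBr br r) a b x
      = b (br x (contract r a)) - a (br x (contract r b)) := by
  have := hr.apply_contract (a ∘ₗ br x) b
  simp only [LinearMap.comp_apply] at this
  rw [dualOp_apply, coboundaryBr_apply, map_add, dualDistrib_map, dualDistrib_map]
  simp only [LinearMap.id_apply, this, LinearMap.comp_id]
  ring

end Coboundary

/-! ### Operators acting on one leg of a tensor. -/

section TensorMaps

variable {K A : Type*} [Field K] [AddCommGroup A] [Module K A]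

theorem onLeft_neg (f : A →ₗ[K] A) (t : A ⊗[K] A) : onLeft (-f) t = -onLeft f t := by
  rw [← neg_one_smul K f, onLeft, TensorProduct.map_smul_left, LinearMap.smul_apply, neg_one_smul]

theorem onRight_neg (f : A →ₗ[K] A) (t : A ⊗[K] A) : onRight (-f) t = -onRight f t := by
  rw [← neg_one_smul K f, onRight, TensorProduct.map_smul_right, LinearMap.smul_apply,
    neg_one_smul]

theorem onLeft_add (f g : A →ₗ[K] A) (t : A ⊗[K] A) :
    onLeft (f + g) t = onLeft f t + onLeft g t := by
  rw [onLeft, TensorProduct.map_add_left, LinearMap.add_apply]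

theorem onRight_add (f g : A →ₗ[K] A) (t : A ⊗[K] A) :
    onRight (f + g) t = onRight f t + onRight g t := by
  rw [onRight, TensorProduct.map_add_right, LinearMap.add_apply]

theorem onLeft_sub (f g : A →ₗ[K] A) (t : A ⊗[K] A) :
    onLeft (f - g) t = onLeft f t - onLeft g t := by
  rw [sub_eq_add_neg, onLeft_add, onLeft_neg, sub_eq_add_neg]

theorem onRight_sub (f g : A →ₗ[K] A) (t : A ⊗[K] A) :
    onRight (f - g) t = onRight f t - onRight g t := by
  rw [sub_eq_add_neg, onRight_add, onRight_neg, sub_eq_add_neg]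

theorem onLeft_comp (f g : A →ₗ[K] A) (t : A ⊗[K] A) :
    onLeft (f ∘ₗ g) t = onLeft f (onLeft g t) := by
  simp only [onLeft, TensorProduct.map_map, LinearMap.id_comp]

theorem onRight_comp (f g : A →ₗ[K] A) (t : A ⊗[K] A) :
    onRight (f ∘ₗ g) t = onRight f (onRight g t) := by
  simp only [onRight, TensorProduct.map_map, LinearMap.id_comp]

theorem onRight_onLeft (f g : A →ₗ[K] A) (t : A ⊗[K] A) :
    onRight g (onLeft f t) = onLeft f (onRight g t) := by
  simp only [onLeft, onRight, TensorProduct.map_map, LinearMap.id_comp, LinearMap.comp_id]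

end TensorMaps

/-! ### The double as a semi-direct product, and the coboundary bialgebra. -/

section Coboundary

variable {K A : Type*} [Field K] [AddCommGroup A] [Module K A]
  {mul br : A →ₗ[K] A →ₗ[K] A} {P : A →ₗ[K] A} {r : A ⊗[K] A}

theorem eq_of_forall_dual {x y : A} (h : ∀ c : Module.Dual K A, c x = c y) : x = y := by
  rw [← sub_eq_zero, ← Module.forall_dual_apply_eq_zero_iff K]
  exact fun c => by rw [map_sub, h, sub_self]

/-- The isomorphism `(x, a) ↦ (x + r(a), a)` from the double of a coboundary bialgebra to the
semi-direct product. -/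
noncomputable def doubleToSemidirect (r : A ⊗[K] A) :
    (A × Module.Dual K A) →ₗ[K] (A × Module.Dual K A) :=
  (LinearMap.fst K A (Module.Dual K A)
    + contract r ∘ₗ LinearMap.snd K A (Module.Dual K A)).prod (LinearMap.snd K A _)

@[simp]
theorem doubleToSemidirect_apply (r : A ⊗[K] A) (p : A × Module.Dual K A) :
    doubleToSemidirect r p = (p.1 + contract r p.2, p.2) := rfl

theorem doubleToSemidirect_injective (r : A ⊗[K] A) :
    Function.Injective (doubleToSemidirect r) := by
  rintro ⟨x, a⟩ ⟨y, b⟩ hxy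
  simp only [doubleToSemidirect_apply, Prod.mk.injEq] at hxy
  obtain ⟨hx, rfl⟩ := hxy
  simpa using hx

/-- This is `eq₂` with its first leg contracted against `a`. -/
theorem IsRPYBESolution.contract_dualMap {Q : A →ₗ[K] A} (h : IsRPYBESolution mul br P Q r)
    (a : Module.Dual K A) : contract r (Q.dualMap a) = P (contract r a) := by
  have := congrArg (fun t => contract t a) (sub_eq_zero.1 h.eq₂)
  simp only [contract_map, LinearMap.id_apply, LinearMap.comp_id] at this
  exact this

variable [FiniteDimensional K A]

/-- Tested on `c`, skewness moves `contract r` from the product `a · b` onto `c`; what remains is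
the scalar form of the AYBE. -/
theorem AYBE.contract_dualOp (h : AYBE mul r) (hr : IsAntisymmetric r) (hA : IsCommAssoc mul)
    (a b : Module.Dual K A) : contract r (dualOp (coboundaryMul mul r) a b)
      = mul (contract r a) (contract r b) := by
  refine eq_of_forall_dual (K := K) fun c => ?_
  have := hr.aybe_iff.1 h a b c
  rw [hr.apply_contract, hr.dualOp_coboundaryMul, hA.comm _ (contract r a),
    hA.comm _ (contract r b)]
  linear_combination -this

theorem CYBE.contract_dualOp (h : CYBE br r) (hr : IsAntisymmetric r) (hA : IsLie br)
    (a b : Module.Dual K A) : contract r (dualOp (coboundaryBr br r) a b)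
      = br (contract r a) (contract r b) := by
  refine eq_of_forall_dual (K := K) fun c => ?_
  have := hr.cybe_iff.1 h a b c
  rw [hr.apply_contract, hr.dualOp_coboundaryBr, hA.skew _ (contract r a),
    hA.skew _ (contract r b), map_neg, map_neg]
  linear_combination -this

theorem doubleMul_apply (mul : A →ₗ[K] A →ₗ[K] A) (Δ : A →ₗ[K] A ⊗[K] A)
    (p q : A × Module.Dual K A) : doubleMul mul Δ p q
      = (mul p.1 q.1 - codualRep (dualOp Δ) p.2 q.1 - codualRep (dualOp Δ) q.2 p.1,
        dualOp Δ p.2 q.2 - dualRep mul p.1 q.2 - dualRep mul q.1 p.2) := by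
  simp only [sub_eq_add_neg]
  rfl

theorem doubleBr_apply (br : A →ₗ[K] A →ₗ[K] A) (δ : A →ₗ[K] A ⊗[K] A)
    (p q : A × Module.Dual K A) : doubleBr br δ p q
      = (br p.1 q.1 + codualRep (dualOp δ) p.2 q.1 - codualRep (dualOp δ) q.2 p.1,
        dualOp δ p.2 q.2 + dualRep br p.1 q.2 - dualRep br q.1 p.2) := rfl

/-- Hence the mixed product of `x` and `a` in the double is `x · r(a) + r(𝓛*(x) a)` in `A` and
`-𝓛*(x) a` in `A*`. Adding `r` of the second component to the first leaves `x · r(a)`. -/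
theorem IsAntisymmetric.codualRep_mul (hr : IsAntisymmetric r)
    (a : Module.Dual K A) (x : A) : codualRep (dualOp (coboundaryMul mul r)) a x
      = -mul x (contract r a) - contract r (dualRep mul x a) := by
  refine eq_of_forall_dual (K := K) fun c => ?_
  rw [apply_codualRep, hr.dualOp_coboundaryMul, map_sub, hr.apply_contract, dualRep_apply,
    map_neg]
  ring

theorem IsAntisymmetric.codualRep_br (hr : IsAntisymmetric r)
    (a : Module.Dual K A) (x : A) : codualRep (dualOp (coboundaryBr br r)) a x
      = -br x (contract r a) + contract r (dualRep br x a) := by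
  refine eq_of_forall_dual (K := K) fun c => ?_
  rw [apply_codualRep, hr.dualOp_coboundaryBr, map_add, hr.apply_contract, dualRep_apply,
    map_neg]
  ring

theorem doubleToSemidirect_mul (h : AYBE mul r) (hr : IsAntisymmetric r) (hA : IsCommAssoc mul)
    (p q : A × Module.Dual K A) :
    doubleToSemidirect r (doubleMul mul (coboundaryMul mul r) p q)
      = semidirectMul mul (-dualRep mul) (doubleToSemidirect r p) (doubleToSemidirect r q) := by
  refine Prod.ext ?_ ?_
  · simp only [doubleToSemidirect_apply, doubleMul_apply, semidirectMul_apply,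
      hr.codualRep_mul, map_sub, map_add, h.contract_dualOp hr hA, LinearMap.add_apply]
    rw [hA.comm q.1]
    abel
  · refine LinearMap.ext fun x => ?_
    simp only [doubleToSemidirect_apply, doubleMul_apply, semidirectMul_apply,
      LinearMap.sub_apply, LinearMap.add_apply, LinearMap.neg_apply, dualRep_apply,
      hr.dualOp_coboundaryMul, map_add, neg_neg]
    rw [hA.comm x, hA.comm x]
    ring

theorem doubleToSemidirect_br (h : CYBE br r) (hr : IsAntisymmetric r) (hA : IsLie br)
    (p q : A × Module.Dual K A) :
    doubleToSemidirect r (doubleBr br (coboundaryBr br r) p q)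
      = semidirectBr br (dualRep br) (doubleToSemidirect r p) (doubleToSemidirect r q) := by
  refine Prod.ext ?_ ?_
  · simp only [doubleToSemidirect_apply, doubleBr_apply, semidirectBr_apply,
      hr.codualRep_br, map_sub, map_add, h.contract_dualOp hr hA, LinearMap.add_apply]
    rw [hA.skew q.1]
    abel
  · refine LinearMap.ext fun x => ?_
    simp only [doubleToSemidirect_apply, doubleBr_apply, semidirectBr_apply,
      LinearMap.sub_apply, LinearMap.add_apply, dualRep_apply,
      hr.dualOp_coboundaryBr, map_add]
    rw [hA.skew x, hA.skew x, map_neg, map_neg]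
    ring

/-- The double of the coboundary bialgebra of an antisymmetric solution of the RPYBE. -/
theorem IsRPYBESolution.isRelativePoisson_double {Q : A →ₗ[K] A}
    (h : IsRPYBESolution mul br P Q r) (hr : IsAntisymmetric r)
    (hA : IsRelativePoisson mul br P) (hQ : DuallyRepresents mul br P Q) :
    IsRelativePoisson (doubleMul mul (coboundaryMul mul r)) (doubleBr br (coboundaryBr br r))
      (doubleP P Q) :=
  (hQ.isRelativePoisson_semidirect hA).of_injective (doubleToSemidirect r)
    (doubleToSemidirect_injective r) (doubleToSemidirect_mul h.aybe hr hA.commAssoc)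
    (doubleToSemidirect_br h.cybe hr hA.lie) fun p => by
      refine Prod.ext ?_ rfl
      simp [doubleP, h.contract_dualMap]

/-- The dual space is a subalgebra of the double. -/
theorem isRelativePoisson_dual_of_double {Δ δ : A →ₗ[K] A ⊗[K] A} {Q : A →ₗ[K] A}
    (h : IsRelativePoisson (doubleMul mul Δ) (doubleBr br δ) (doubleP P Q)) :
    IsRelativePoisson (dualOp Δ) (dualOp δ) Q.dualMap := by
  refine h.of_injective (LinearMap.inr K A (Module.Dual K A)) LinearMap.inr_injective ?_ ?_ ?_
  · intro a b
    simp [doubleMul_apply]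
  · intro a b
    simp [doubleBr_apply]
  · intro a
    simp [doubleP]

/-- The coboundary bialgebra of an antisymmetric solution of the RPYBE associated to `-P`. -/
theorem IsRPYBESolution.isRelativePoissonBialgebra (h : IsRPYBESolution mul br P (-P) r)
    (hr : IsAntisymmetric r) (hA : IsRelativePoisson mul br P) :
    IsRelativePoissonBialgebra mul br (coboundaryMul mul r) (coboundaryBr br r) P (-P) := by
  have hP : onLeft P r + onRight P r = 0 := by
    have := h.eq₁
    rwa [onRight_neg, sub_neg_eq_add] at this
  -- The axioms are put as identities between operators, so that they can be applied in either leg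
  -- of `r`.
  have hmul : ∀ x y, mul (mul x y) = mul x ∘ₗ mul y := fun x y =>
    LinearMap.ext fun z => hA.commAssoc.assoc x y z
  have hbr : ∀ x y, br (br x y) = br x ∘ₗ br y - br y ∘ₗ br x := fun x y =>
    LinearMap.ext fun z => hA.lie.leibniz x y z
  have hbm : ∀ x y, br x ∘ₗ mul y = mul (br x y) + mul y ∘ₗ br x + mul (mul (P x) y) :=
    fun x y => LinearMap.ext fun z => by
      have e : mul (mul y z) (P x) = mul (mul (P x) y) z := by
        rw [hA.commAssoc.comm _ (P x), hA.commAssoc.assoc]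
      simp [hA.leibniz y z x, e]
  have hPm : ∀ x, P ∘ₗ mul x = mul (P x) + mul x ∘ₗ P := fun x =>
    LinearMap.ext fun z => hA.derivation_mul x z
  have hPb : ∀ x, P ∘ₗ br x = br (P x) + br x ∘ₗ P := fun x =>
    LinearMap.ext fun z => hA.derivation_br x z
  constructor
  · exact hA
  · exact (isRelativePoisson_dual_of_double
      (h.isRelativePoisson_double hr hA hA.duallyRepresents_neg)).isRelativePoissonCoalgebra
  · intro x y
    have e := congrArg (onRight · r) ((hmul y x).symm.trans (by rw [hA.commAssoc.comm]))
    simp only [onRight_comp] at e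
    simp only [coboundaryMul_apply, map_sub, onRight_onLeft, e, hmul x y, onLeft_comp]
    abel
  · intro x y
    simp only [coboundaryBr_apply, map_add, onRight_onLeft, hbr, onLeft_sub, onRight_sub,
      onLeft_comp, onRight_comp]
    abel
  · exact hA.duallyRepresents_neg
  -- As `Q = -P`, both legs carry `P`. The claim holds because `P` is a derivation and `P ⊗ id + id
  -- ⊗ P` kills `r`; the next goal is the same for the bracket.
  · intro x
    have e₁ := congrArg (onRight · r) (hPm x)
    have e₂ := congrArg (onLeft · r) (hPm x)
    have e₃ := congrArg (onRight (mul x)) hP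
    have e₄ := congrArg (onLeft (mul x)) hP
    simp only [onRight_comp, onLeft_comp, onRight_add, onLeft_add, map_add, map_zero,
      onRight_onLeft] at e₁ e₂ e₃ e₄
    simp only [coboundaryMul_apply, onRight_neg, map_sub, map_neg, onRight_onLeft]
    linear_combination (norm := abel) -e₁ + e₂ - e₃ + e₄
  · intro x
    have e₁ := congrArg (onRight · r) (hPb x)
    have e₂ := congrArg (onLeft · r) (hPb x)
    have e₃ := congrArg (onRight (br x)) hP
    have e₄ := congrArg (onLeft (br x)) hP
    simp only [onRight_comp, onLeft_comp, onRight_add, onLeft_add, map_add, map_zero,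
      onRight_onLeft] at e₁ e₂ e₃ e₄
    simp only [coboundaryBr_apply, onRight_neg, map_add, map_neg, onRight_onLeft]
    linear_combination (norm := abel) -e₁ - e₂ - e₃ - e₄
  · intro x
    simp
  · intro x y
    -- Two expansions of `ad(x · y)`, one per leg. The `P` term of `h₂` cancels against `(id ⊗ Q)
    -- Δ(x · y)`; what is left there joins the `P` term of `h₁` in `-(𝓛(x · y) ⊗ id)(P ⊗ id + id ⊗
    -- P) r = 0`.
    have h₁ : br (mul x y) = mul x ∘ₗ br y + mul y ∘ₗ br x - mul (mul x y) ∘ₗ P :=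
      LinearMap.ext fun z => hA.leibniz_left x y z
    have h₂ : br (mul x y) = br y ∘ₗ mul x + br x ∘ₗ mul y - P ∘ₗ mul (mul x y) :=
      LinearMap.ext fun z => by
        have := hA.cyclic_leibniz x y z
        simp only [LinearMap.add_apply, LinearMap.sub_apply, LinearMap.comp_apply]
        linear_combination (norm := abel) -this
    have e₁ := congrArg (onLeft · r) h₁
    have e₂ := congrArg (onRight · r) h₂
    have e₃ := congrArg (onLeft (mul (mul x y))) hP
    simp only [onRight_comp, onLeft_comp, onRight_add, onLeft_add, onRight_sub, onLeft_sub,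
      map_add, map_zero] at e₁ e₂ e₃
    simp only [coboundaryBr_apply, coboundaryMul_apply, onRight_neg, map_add, map_sub, map_neg,
      onRight_onLeft]
    linear_combination (norm := abel) e₁ + e₂ - e₃
  · intro x y
    have e₁ := congrArg (onLeft · r) (hbm x y)
    have e₂ := congrArg (onRight · r) (hbm x y)
    simp only [onRight_comp, onLeft_comp, onRight_add, onLeft_add] at e₁ e₂
    simp only [coboundaryBr_apply, coboundaryMul_apply, map_add, map_sub, onRight_onLeft]
    linear_combination (norm := abel) e₁ - e₂

/-- The double of the coboundary bialgebra of an antisymmetric solution of the RPYBE in a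
Jacobi algebra is a Jacobi algebra with the same unit. -/
theorem IsRPYBESolution.isJacobi_double (h : IsRPYBESolution mul br P (-P) r)
    (hr : IsAntisymmetric r) (hA : IsRelativePoisson mul br P) {e : A}
    (he : IsUnitElement mul e) (hP : ∀ x, br e x = P x) :
    IsJacobi (doubleMul mul (coboundaryMul mul r)) (doubleBr br (coboundaryBr br r))
      ((e, 0) : A × Module.Dual K A) := by
  have hd := h.isRelativePoisson_double hr hA hA.duallyRepresents_neg
  have hunit : ∀ p, doubleMul mul (coboundaryMul mul r) (e, 0) p = p := fun p => by
    refine doubleToSemidirect_injective r ?_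
    rw [doubleToSemidirect_mul h.aybe hr hA.commAssoc]
    refine Prod.ext ?_ (LinearMap.ext fun x => ?_)
    · simp [(he _).1]
    · simp [dualRep_apply, (he _).1]
  refine hd.isJacobi (fun p => ⟨hunit p, by rw [hd.commAssoc.comm, hunit]⟩) fun p => ?_
  -- In the semi-direct product, `(e, 0)` acts by `P` on the first summand and by `(-P)*` on the
  -- second; `contract_dualMap` matches this with the transported derivation.
  refine doubleToSemidirect_injective r ?_
  rw [doubleToSemidirect_br h.cybe hr hA.lie]
  refine Prod.ext ?_ (LinearMap.ext fun x => ?_)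
  · have := h.contract_dualMap p.2
    simp [hP, doubleP, this]
  · simp [dualRep_apply, doubleP, hP]

end Coboundary

/-! ### The natural pairing on the double. -/

section Form

variable {K A : Type*} [Field K] [AddCommGroup A] [Module K A]

theorem doubleForm_apply (p q : A × Module.Dual K A) :
    doubleForm K A p q = q.2 p.1 + p.2 q.1 := rfl

theorem doubleForm_isSymm : (doubleForm K A).IsSymm :=
  ⟨fun p q => by simp only [doubleForm_apply]; ring⟩

theorem doubleForm_nondegenerate : (doubleForm K A).Nondegenerate := by
  have h : ∀ p : A × Module.Dual K A, (∀ q, doubleForm K A p q = 0) → p = 0 := fun p hp => by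
    refine Prod.ext ?_ (LinearMap.ext fun x => ?_)
    · change p.1 = 0
      rw [← Module.forall_dual_apply_eq_zero_iff K]
      intro c
      simpa [doubleForm_apply] using hp (0, c)
    · simpa [doubleForm_apply] using hp (x, 0)
  refine ⟨h, fun q hq => h q fun p => ?_⟩
  rw [doubleForm_apply, add_comm]
  exact hq p

variable [FiniteDimensional K A]

/-- The double is Frobenius as soon as it is a Jacobi algebra. -/
theorem IsJacobi.isFrobeniusJacobi_double {mul br : A →ₗ[K] A →ₗ[K] A}
    {Δ δ : A →ₗ[K] A ⊗[K] A} {e : A × Module.Dual K A}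
    (h : IsJacobi (doubleMul mul Δ) (doubleBr br δ) e)
    (hmul : IsCommAssoc mul) (hbr : IsLie br) (hΔ : IsCommAssoc (dualOp Δ))
    (hδ : IsLie (dualOp δ)) :
    IsFrobeniusJacobi (doubleMul mul Δ) (doubleBr br δ) e (doubleForm K A) where
  jacobi := h
  nondegenerate := doubleForm_nondegenerate
  symm := doubleForm_isSymm
  invariant_mul x y z := by
    -- Moving the mixed actions across the pairing leaves only products within each half; both sides
    -- then agree up to commutativity.
    simp only [doubleForm_apply, doubleMul_apply, map_sub, apply_codualRep, dualRep_apply,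
      LinearMap.sub_apply]
    rw [hΔ.comm z.2 x.2, hmul.comm z.1 x.1, hΔ.comm y.2 x.2, hmul.comm y.1 x.1]
    ring
  invariant_br x y z := by
    simp only [doubleForm_apply, doubleBr_apply, map_sub, map_add, apply_codualRep,
      dualRep_apply, LinearMap.sub_apply, LinearMap.add_apply]
    rw [hδ.skew z.2 x.2, hbr.skew z.1 x.1, hδ.skew y.2 x.2, hbr.skew y.1 x.1]
    simp only [LinearMap.neg_apply, map_neg]
    ring

end Form

/-! ### The canonical tensor of a relative pre-Poisson algebra. -/

section PrePoisson

variable {K A : Type*} [Field K] [AddCommGroup A] [Module K A]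
  {star circ : A →ₗ[K] A →ₗ[K] A} {P : A →ₗ[K] A}

/-- The semi-direct product attached to a relative pre-Poisson algebra. -/
theorem IsRelativePrePoisson.isRelativePoisson_extDual (h : IsRelativePrePoisson star circ P) :
    IsRelativePoisson (extDualMul star) (extDualBr circ P) (extDualP P) :=
  h.isRepresentation.isRelativePoisson_semidirect h.isRelativePoisson.ext

theorem isUnitElement_extDual (star : A →ₗ[K] A →ₗ[K] A) :
    IsUnitElement (extDualMul star) (extDualUnit K A) := fun x => by
  constructor <;> ext <;> simp [extDualMul, extDualUnit, dualRep_apply]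

theorem extDualBr_unit (circ : A →ₗ[K] A →ₗ[K] A) (P : A →ₗ[K] A) (x : ExtDual K A) :
    extDualBr circ P (extDualUnit K A) x = extDualP P x := by
  ext <;> simp [extDualBr, extDualUnit, extDualP, dualRep_apply]

theorem isAntisymmetric_extDualTensor {n : ℕ} (b : Module.Basis (Fin n) K A) :
    IsAntisymmetric (extDualTensor b) := by
  simp [IsAntisymmetric, extDualTensor]

/-- The vector of `A` that represents the restriction of `a` to `A*`. -/
noncomputable def restrictDual {n : ℕ} (b : Module.Basis (Fin n) K A)
    (a : Module.Dual K (ExtDual K A)) : A := ∑ i, a (0, b.coord i) • b i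

/-- The restriction of `a` to `A`. -/
noncomputable def restrictBase (a : Module.Dual K (ExtDual K A)) : Module.Dual K A :=
  a ∘ₗ LinearMap.inl K (A × K) (Module.Dual K A) ∘ₗ LinearMap.inl K A K

theorem apply_base (a : Module.Dual K (ExtDual K A)) (x : A) :
    a ((x, 0), 0) = restrictBase a x := rfl

theorem apply_dual {n : ℕ} (b : Module.Basis (Fin n) K A)
    (a : Module.Dual K (ExtDual K A)) (u : Module.Dual K A) :
    a (0, u) = u (restrictDual b a) := by
  have e : u = ∑ i, u (b i) • b.coord i := b.ext fun j => by
    simp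
  have := congrArg (a ∘ₗ LinearMap.inr K (A × K) (Module.Dual K A)) e
  simp only [map_sum, map_smul, LinearMap.comp_apply, LinearMap.inr_apply] at this
  rw [this, restrictDual, map_sum]
  exact Finset.sum_congr rfl fun i _ => by simp [mul_comm]

theorem apply_base_dual {n : ℕ} (b : Module.Basis (Fin n) K A)
    (a : Module.Dual K (ExtDual K A)) (x : A) (u : Module.Dual K A) :
    a ((x, 0), u) = restrictBase a x + u (restrictDual b a) := by
  rw [← apply_base, ← apply_dual b, ← map_add]
  simp

/-- The value of `a` at e does not enter, so the image lies in `A ⊕ A*`, and the Yang-Baxter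
equations only involve `⋆` and `∘` on `A`. -/
theorem contract_extDualTensor {n : ℕ} (b : Module.Basis (Fin n) K A)
    (a : Module.Dual K (ExtDual K A)) :
    contract (extDualTensor b) a = ((-restrictDual b a, 0), restrictBase a) := by
  have e : restrictBase a = ∑ i, a ((b i, 0), 0) • b.coord i := b.ext fun j => by
    simp [apply_base]
  rw [e, extDualTensor, restrictDual, map_sum, LinearMap.sum_apply]
  ext <;> simp [Prod.fst_sum, Prod.snd_sum]

/-- The canonical tensor is killed because the map acts on `A*` by minus the transpose of its action
on `A`. -/
theorem onLeft_add_onRight_extDualP {n : ℕ} (b : Module.Basis (Fin n) K A) [FiniteDimensional K A] :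
    onLeft (extDualP P) (extDualTensor b) + onRight (extDualP P) (extDualTensor b) = 0 := by
  refine eq_zero_of_dualDistrib fun a c => ?_
  rw [map_add, dualDistrib_map, dualDistrib_map, LinearMap.comp_id, LinearMap.id_apply]
  have e := (isAntisymmetric_extDualTensor b).apply_contract (a ∘ₗ extDualP P) c
  rw [e, LinearMap.comp_apply, contract_extDualTensor, contract_extDualTensor]
  simp [extDualP, apply_base_dual b]
  ring

/-- The canonical tensor is a solution of the RPYBE associated to `-P̃ + P*`. -/
theorem isRPYBESolution_extDualTensor {n : ℕ} (b : Module.Basis (Fin n) K A)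
    [FiniteDimensional K A] (star circ : A →ₗ[K] A →ₗ[K] A) (P : A →ₗ[K] A) :
    IsRPYBESolution (extDualMul star) (extDualBr circ P) (extDualP P) (-extDualP P)
      (extDualTensor b) where
  aybe := by
    rw [(isAntisymmetric_extDualTensor b).aybe_iff]
    intro a₁ a₂ a₃
    -- Write `r(aᵢ) = -vᵢ + fᵢ`. The term of `a₁` is `f₁(v₂ ⋆ v₃ + v₃ ⋆ v₂) - f₃(v₂ ⋆ v₁) - f₂(v₃ ⋆
    -- v₁)`, and the three such terms cancel in the sum. For the bracket the same happens with `∘`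
    -- antisymmetrized.
    simp [contract_extDualTensor, extDualMul, apply_base_dual b, dualRep_apply]
    ring
  cybe := by
    rw [(isAntisymmetric_extDualTensor b).cybe_iff]
    intro a₁ a₂ a₃
    simp [contract_extDualTensor, extDualBr, apply_base_dual b, dualRep_apply]
    ring
  eq₁ := by
    rw [onRight_neg, sub_neg_eq_add, onLeft_add_onRight_extDualP]
  eq₂ := by
    rw [onLeft_neg, ← neg_add', onLeft_add_onRight_extDualP, neg_zero]

end PrePoisson

end RelativePoisson

theorem theorem5p8 {K A : Type*} [Field K] [IsAlgClosed K] [CharZero K]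
    [AddCommGroup A] [Module K A] [FiniteDimensional K A]
    (star circ : A →ₗ[K] A →ₗ[K] A) (P : A →ₗ[K] A)
    (h : IsRelativePrePoisson star circ P)
    {n : ℕ} (b : Module.Basis (Fin n) K A)
    (r : ExtDual K A ⊗[K] ExtDual K A) (hr : r = extDualTensor b)
    (Δ δ : ExtDual K A →ₗ[K] ExtDual K A ⊗[K] ExtDual K A)
    (hΔ : Δ = coboundaryMul (extDualMul star) r)
    (hδ : δ = coboundaryBr (extDualBr circ P) r) :
    -- the extended Jacobi algebra of the sub-adjacent relative Poisson algebra
    (IsRelativePoisson (subMul star) (subBr circ) P ∧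
      IsJacobi (extMul (subMul star)) (extBr (subBr circ) P) ((0, 1) : A × K)) ∧
    -- the semi-direct product is a unital relative Poisson algebra
    (IsRelativePoisson (extDualMul star) (extDualBr circ P) (extDualP P) ∧
      IsUnitElement (extDualMul star) (extDualUnit K A)) ∧
    -- the antisymmetric solution of the RPYBE
    (IsAntisymmetric r ∧
      IsRPYBESolution (extDualMul star) (extDualBr circ P) (extDualP P) (-extDualP P) r) ∧
    -- the relative Poisson bialgebra
    IsRelativePoissonBialgebra (extDualMul star) (extDualBr circ P) Δ δ
      (extDualP P) (-extDualP P) ∧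
    -- the induced relative Poisson algebra is a Frobenius Jacobi algebra
    (IsRelativePoisson (doubleMul (extDualMul star) Δ) (doubleBr (extDualBr circ P) δ)
        (doubleP (extDualP P) (-extDualP P)) ∧
      IsFrobeniusJacobi (doubleMul (extDualMul star) Δ) (doubleBr (extDualBr circ P) δ)
        ((extDualUnit K A, 0) : ExtDual K A × Module.Dual K (ExtDual K A))
        (doubleForm K (ExtDual K A))) := by
  subst hr hΔ hδ
  have hA := h.isRelativePoisson
  have hX := h.isRelativePoisson_extDual
  have hu := isUnitElement_extDual star
  have hanti := isAntisymmetric_extDualTensor b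
  have hr := isRPYBESolution_extDualTensor b star circ P
  have hd := hr.isRelativePoisson_double hanti hX hX.duallyRepresents_neg
  have hdual := isRelativePoisson_dual_of_double hd
  exact ⟨⟨hA, hA.ext.isJacobi (isUnitElement_ext _) (extBr_unit _ _)⟩, ⟨hX, hu⟩, ⟨hanti, hr⟩,
    hr.isRelativePoissonBialgebra hanti hX, hd,
    (hr.isJacobi_double hanti hX hu (extDualBr_unit circ P)).isFrobeniusJacobi_double
      hX.commAssoc hX.lie hdual.commAssoc hdual.lie⟩
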